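/- Let $G$ be a finite connected directed graph, with multiple edges allowed and no looped edges, regarded as a topological space in which every edge is identified with $[0,1]$. Let $p:\widetilde G\to G$ be its universal cover, and let $\pi$ be its group of covering transformations (identified with the fundamental group of $G$). Let $f:G\to G$ be a continuous map that permutes the vertices and is homotopic to the identity, and let $\widetilde f$ be a lift of $f$ to $\widetilde G$ that commutes with all elements of $\pi$. Let $L_f$ be the linearization of $f$: the map homotopic to $f$ relative to the vertices that maps each edge linearly onto a contracted edge path. Let $\widetilde L_f$ be the lift of $L_f$ obtained by lifting such a homotopy from $f$ to $L_f$, starting at $\widetilde f$. Let $E$ be an edge of $G$ and $\widetilde E$ a lift of $E$ to $\widetilde G$. For a point $x$ of $E$, including its end points, let $\widetilde x$ be the corresponding point of $\widetilde E$. For $g=f$ or $g=L_f$, $n\ge 1$ and $g^n(x)=x$, the rotation element of $x$ is $\rho(x)=w^{1/n}$, where $w\in\pi$ is determined by $\widetilde g^{\,n}(\widetilde x)=w\widetilde x$. For $\alpha,\beta\in\pi$ let $\mathcal S(\alpha^{1/m},\beta^{1/n})$ be the set of all $v^{1/(rm+sn)}$, where $v$ is a nonempty product, in any order, of $r$ copies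 of $\alpha$ and $s$ copies of $\beta$. Theorem. Suppose that $L_f$ has periodic points $x\in\mathrm{Fix}(L_f^m)$ and $y\in\mathrm{Fix}(L_f^n)$ in the interior of the common edge $E$ (where $m,n\ge1$), with rotation elements $\alpha^{1/m}$ and $\beta^{1/n}$ with respect to $\widetilde L_f$. Let $v^{1/k}\in\mathcal S(\alpha^{1/m},\beta^{1/n})$, where $k=rm+sn$. Then there is a point $z$ of the closed edge $E$ with $f^k(z)=z$ and $\widetilde f^{\,k}(\widetilde z)=v\widetilde z$, so that $z$ has rotation element $v^{1/k}$ with respect to $\widetilde f$. Moreover $z$ can be chosen in the interior of $E$, except possibly in the following two cases: 1. both $L_f^m$ and $L_f^n$ restrict to the identity on $E$; 2. $\alpha\beta\ne\beta\alpha$; for some $j\ge1$ we have $k=j(m+n)$ and $v\in\{(\alpha\beta)^j,(\beta\alpha)^j\}$; and $\widetilde f^{\,m}(\widetilde a)=\alpha\widetilde b$, $\widetilde f^{\,n}(\widetilde b)=\beta\widetilde a$, where $\widetilde a,\widetilde b$ are the two end points of $\widetilde E$ in one of the two orders. -/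

import Mathlib

/-- A directed graph with vertex set `V` and edge set `E`: multiple edges between two vertices are
allowed, looped edges are not. -/
structure DirectedGraph (V E : Type*) where
  src : E → V
  tgt : E → V
  src_ne_tgt : ∀ e, src e ≠ tgt e

namespace DirectedGraph

variable {V E : Type*}

/-- The disjoint union of one point for each vertex and one unit interval for each edge. -/
abbrev Cells (V E : Type*) := (Σ _ : V, PUnit.{1}) ⊕ (Σ _ : E, unitInterval)

/-- The two ends of the interval of an edge are glued to the initial and the terminal vertex. -/
inductive Glue (G : DirectedGraph V E) : Cells V E → Cells V E → Prop
  | src (e : E) : Glue G (Sum.inr ⟨e, 0⟩) (Sum.inl ⟨G.src e, PUnit.unit⟩)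
  | tgt (e : E) : Glue G (Sum.inr ⟨e, 1⟩) (Sum.inl ⟨G.tgt e, PUnit.unit⟩)

/-- The graph as a topological space. -/
def Space (G : DirectedGraph V E) : Type _ := Quot G.Glue

instance (G : DirectedGraph V E) : TopologicalSpace G.Space :=
  inferInstanceAs (TopologicalSpace (Quot G.Glue))

/-- The point of the graph given by a vertex. -/
def vertexPt (G : DirectedGraph V E) (v : V) : G.Space := Quot.mk _ (Sum.inl ⟨v, PUnit.unit⟩)

/-- The point with coordinate `t ∈ [0,1]` on the edge `e`. -/
def edgePt (G : DirectedGraph V E) (e : E) (t : unitInterval) : G.Space :=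
  Quot.mk _ (Sum.inr ⟨e, t⟩)

/-- The set of vertices in the space of the graph. -/
def vertexSet (G : DirectedGraph V E) : Set G.Space := Set.range G.vertexPt

theorem edgePt_zero (G : DirectedGraph V E) (e : E) : G.edgePt e 0 = G.vertexPt (G.src e) :=
  Quot.sound (Glue.src e)

theorem edgePt_one (G : DirectedGraph V E) (e : E) : G.edgePt e 1 = G.vertexPt (G.tgt e) :=
  Quot.sound (Glue.tgt e)

/-- Oriented edges: `(e, true)` is `e`, and `(e, false)` is `e` traversed backwards. -/
def orientedSrc (G : DirectedGraph V E) (a : E × Bool) : V := if a.2 then G.src a.1 else G.tgt a.1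

def orientedTgt (G : DirectedGraph V E) (a : E × Bool) : V := if a.2 then G.tgt a.1 else G.src a.1

/-- The point reached after traversing the part `u ∈ [0,1]` of an oriented edge. -/
def orientedPt (G : DirectedGraph V E) (a : E × Bool) (u : unitInterval) : G.Space :=
  if a.2 then G.edgePt a.1 u else G.edgePt a.1 (unitInterval.symm u)

/-- The sequence `s` of oriented edges is a contracted edge path: consecutive edges fit together,
and no edge is followed by its own reverse. -/
def IsContractedPath (G : DirectedGraph V E) {N : ℕ} (s : Fin N → E × Bool) : Prop :=
  ∀ (i : ℕ) (h : i + 1 < N),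
    G.orientedTgt (s ⟨i, Nat.lt_of_succ_lt h⟩) = G.orientedSrc (s ⟨i + 1, h⟩) ∧
    s ⟨i + 1, h⟩ ≠ ((s ⟨i, Nat.lt_of_succ_lt h⟩).1, !(s ⟨i, Nat.lt_of_succ_lt h⟩).2)

/-- `L` maps the edge `e` linearly onto a contracted path of `N` edges: the point with coordinate
`t` goes to the point at distance `N * t` from the start of the path.  (For a vertex map of a graph
without looped edges the two ends of `e` have different images, so `N` is positive.) -/
def IsLinearOnEdge (G : DirectedGraph V E) (L : C(G.Space, G.Space)) (e : E) : Prop :=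
  ∃ (N : ℕ) (s : Fin N → E × Bool), 0 < N ∧ G.IsContractedPath s ∧
    ∀ (i : Fin N) (t u : unitInterval), (t : ℝ) * N = (i : ℕ) + (u : ℝ) →
      L (G.edgePt e t) = G.orientedPt (s i) u

/-- A vertex map: a continuous map that permutes the vertices. -/
def IsVertexMap (G : DirectedGraph V E) (f : C(G.Space, G.Space)) : Prop :=
  Set.BijOn f G.vertexSet G.vertexSet

/-- `L` is the linearization of `f`: it is homotopic to `f` relative to the vertices, and it is
linear on every edge. -/
def IsLinearization (G : DirectedGraph V E) (f L : C(G.Space, G.Space)) : Prop :=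
  f.HomotopicRel L G.vertexSet ∧ ∀ e, G.IsLinearOnEdge L e

/-- `L'` is the lift of `L` obtained by lifting a homotopy from `f` to `L`, constant on the
vertices, to the covering space, starting at the lift `f'` of `f`. -/
def IsInducedLift (G : DirectedGraph V E) {T : Type*} [TopologicalSpace T] (p : T → G.Space)
    (f L : C(G.Space, G.Space)) (f' L' : C(T, T)) : Prop :=
  ∃ (h : f.HomotopyRel L G.vertexSet) (h' : f'.Homotopy L'),
    ∀ (s : unitInterval) (a : T), p (h' (s, a)) = h (s, p a)

end DirectedGraph

section Covering

variable {T X : Type*} [TopologicalSpace T]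

/-- The group of covering transformations of `p`; the product is composition.  For the universal
cover it is the fundamental group of the base. -/
def deckGroup (p : T → X) : Subgroup (T ≃ₜ T) where
  carrier := {g | ∀ a, p (g a) = p a}
  one_mem' := fun _ => rfl
  mul_mem' := by
    intro g h hg hh a
    exact (hg (h a)).trans (hh a)
  inv_mem' := by
    intro g hg a
    have h1 := hg (g⁻¹ a)
    have h2 : g (g⁻¹ a) = a := g.apply_symm_apply a
    rw [h2] at h1
    exact h1.symm

/-- `f'` is a lift of `f` that commutes with all covering transformations. -/
def IsEquivariantLift [TopologicalSpace X] (p : T → X) (f : C(X, X)) (f' : C(T, T)) : Prop :=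
  (∀ a, p (f' a) = f (p a)) ∧ ∀ g ∈ deckGroup p, ∀ a, f' (g a) = g (f' a)

/-- With respect to the lift `F`, the point with chosen lift `a` has the rotation element
`w ^ (1 / n)`; the formal root is recorded as the pair `(w, n)`. -/
def HasRotationElement {p : T → X} (F : C(T, T)) (a : T) (q : deckGroup p × ℕ) : Prop :=
  0 < q.2 ∧ F^[q.2] a = (q.1 : T ≃ₜ T) a

end Covering

/-- The set `𝒮(α^(1/m), β^(1/n))` of all `v^(1/(rm+sn))`, where `v` is a nonempty product of
copies of `α` and `β`, built from `r` occurrences of `α` and `s` occurrences of `β`.  In the word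
`l` the letter `true` stands for `α` and `false` for `β`. -/
def rotationSet {Γ : Type*} [Group Γ] (α : Γ) (m : ℕ) (β : Γ) (n : ℕ) : Set (Γ × ℕ) :=
  {q | ∃ l : List Bool, l ≠ [] ∧ q.1 = (l.map fun b => if b then α else β).prod ∧
    q.2 = l.count true * m + l.count false * n}

/-!
Everything takes place in the covering space `T`, which is a tree. An arc is a lift of an edge. In
a simply connected covering space every arc `c` has a coordinate `R : T → [0,1]` with `R (c t) = t`
that is `0` or `1` off the open arc (`exists_coord`): the map to the circle that collapses the
complement of the open arc lifts to the real line. Coordinates replace the combinatorics of the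
tree. They show that a contracted path never returns to an arc that it has left, and hence that
every path with the same end points crosses each of its arcs (`IsArcChain.exists_cross`).

The lifts `f'` and `L'` agree over the vertices. Therefore, whenever `L'` maps a subarc of an arc
`c` linearly onto an arc `d`, the map `f'` maps a subarc of `c` into `d`, end points to end points.
Such a pair of subarcs is a `Crossing`. It records the affine map `φ` that parametrizes the subarc
for `L'`, and the fact that the subarc for `f'` can reach an end point of `c` only if `φ` does.
Crossings compose and are moved by covering transformations, so the itinerary under `L'` of the
periodic point `x`, which never meets a vertex, gives a crossing from the given arc to its
translate by `α`, and `y` gives one for `β`. A word in `α` and `β` gives the composed crossing, and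
the intermediate value theorem gives a fixed point (`Crossing.exists_fixed`). It can be chosen in
the interior unless the affine map of the word fixes an end point.

An affine map of a letter fixes `x` or `y`, hence, if it is not an isometry, it can take an end
point as a value only at the opposite end point, and it does not exchange the end points. A word
that fixes an end point therefore alternates between the two letters
(`exists_alternating_of_wordMap_eq`), and this is the second exceptional case unless
`α * β = β * α`. If the two commute, the words `α β` and `β α` describe the same rotation element
and provide interior points that are mapped to both ends of the translate of the arc; an interior
fixed point lies between them (`exists_interior_of_commute`). If one letter is an isometry, both
are (`isFull_of_isFull`), and if they are not both the identity, both are powers of one iterate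
that reverses the arc and so has an interior fixed point (`exists_interior_of_isFull`).
-/

/-! ### The topology of the graph -/

namespace DirectedGraph

variable {V E : Type*}

/-- A function on the graph given by its values on the vertices and on the edges. -/
def glueFun (G : DirectedGraph V E) {X : Type*} (a : V → X) (b : E → unitInterval → X)
    (h0 : ∀ e, b e 0 = a (G.src e)) (h1 : ∀ e, b e 1 = a (G.tgt e)) : G.Space → X :=
  Quot.lift (Sum.elim (fun v => a v.1) fun q => b q.1 q.2) (by
    rintro _ _ (e | e)
    · exact h0 e
    · exact h1 e)

theorem continuous_glueFun (G : DirectedGraph V E) {X : Type*} [TopologicalSpace X] (a : V → X)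
    (b : E → unitInterval → X) (h0 : ∀ e, b e 0 = a (G.src e)) (h1 : ∀ e, b e 1 = a (G.tgt e))
    (hb : ∀ e, Continuous (b e)) : Continuous (G.glueFun a b h0 h1) := by
  refine continuous_quot_lift _ (continuous_sumElim.2 ⟨?_, ?_⟩)
  · exact continuous_sigma fun v => (continuous_const : Continuous fun _ : PUnit => a v)
  · exact continuous_sigma fun e => hb e

instance (G : DirectedGraph V E) : LocallyPathConnectedSpace G.Space :=
  have : LocallyPathConnectedSpace unitInterval :=
    (convex_Icc (0 : ℝ) 1).locallyPathConnectedSpace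
  inferInstanceAs (LocallyPathConnectedSpace (Quot G.Glue))

theorem continuous_edgePt (G : DirectedGraph V E) (e : E) : Continuous (G.edgePt e) :=
  continuous_quot_mk.comp (continuous_inr.comp continuous_sigmaMk)

theorem vertexPt_or_edgePt (G : DirectedGraph V E) (x : G.Space) :
    (∃ v, x = G.vertexPt v) ∨ ∃ e t, 0 < t ∧ t < 1 ∧ x = G.edgePt e t := by
  induction x using Quot.ind with
  | mk q =>
    rcases q with ⟨v, ⟨⟩⟩ | ⟨e, t⟩
    · exact Or.inl ⟨v, rfl⟩
    · rcases eq_or_ne t 0 with rfl | h0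
      · exact Or.inl ⟨_, G.edgePt_zero e⟩
      rcases eq_or_ne t 1 with rfl | h1
      · exact Or.inl ⟨_, G.edgePt_one e⟩
      exact Or.inr ⟨e, t, unitInterval.pos_iff_ne_zero.2 h0,
        unitInterval.lt_one_iff_ne_one.2 h1, rfl⟩

open Classical in
/-- Barycentric coordinates of a point of the graph with respect to the vertices. -/
noncomputable def vertexCoord (G : DirectedGraph V E) : G.Space → V → ℝ :=
  G.glueFun (fun v => Pi.single v 1)
    (fun e t => (1 - t : ℝ) • Pi.single (G.src e) 1 + (t : ℝ) • Pi.single (G.tgt e) 1)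
    (by simp) (by simp)

open Classical in
/-- For each edge, a function that is positive exactly in the interior of this edge. -/
noncomputable def edgeBump (G : DirectedGraph V E) : G.Space → E → ℝ :=
  G.glueFun (fun _ => 0) (fun e t => Pi.single e (t * (1 - t) : ℝ)) (by simp) (by simp)

theorem edgeBump_edgePt (G : DirectedGraph V E) (e : E) (t : unitInterval) :
    G.edgeBump (G.edgePt e t) e = t * (1 - t) := by
  simp [edgeBump, glueFun, edgePt]

theorem edgeBump_edgePt_of_ne (G : DirectedGraph V E) {e d : E} (h : d ≠ e) (t : unitInterval) :
    G.edgeBump (G.edgePt e t) d = 0 := by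
  simp [edgeBump, glueFun, edgePt, h]

theorem edgeBump_vertexPt (G : DirectedGraph V E) (v : V) : G.edgeBump (G.vertexPt v) = 0 := rfl

theorem vertexCoord_edgePt_tgt (G : DirectedGraph V E) (e : E) (t : unitInterval) :
    G.vertexCoord (G.edgePt e t) (G.tgt e) = t := by
  have := (G.src_ne_tgt e).symm
  simp [vertexCoord, glueFun, edgePt, this]

theorem edgeBump_pos (G : DirectedGraph V E) (e : E) {t : unitInterval} (h0 : 0 < t) (h1 : t < 1) :
    0 < G.edgeBump (G.edgePt e t) e := by
  rw [edgeBump_edgePt]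
  have h0' : (0 : ℝ) < t := h0
  have h1' : (t : ℝ) < 1 := h1
  nlinarith

theorem edgePt_eq_edgePt (G : DirectedGraph V E) {e d : E} {t u : unitInterval}
    (h0 : 0 < t) (h1 : t < 1) (h : G.edgePt e t = G.edgePt d u) : e = d ∧ t = u := by
  have hpos := G.edgeBump_pos e h0 h1
  have hed : e = d := by
    by_contra hne
    rw [h, G.edgeBump_edgePt_of_ne hne] at hpos
    exact lt_irrefl _ hpos
  subst hed
  refine ⟨rfl, Subtype.ext ?_⟩
  rw [← G.vertexCoord_edgePt_tgt e t, h, vertexCoord_edgePt_tgt]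

theorem edgePt_ne_vertexPt (G : DirectedGraph V E) {e : E} {t : unitInterval}
    (h0 : 0 < t) (h1 : t < 1) (v : V) : G.edgePt e t ≠ G.vertexPt v := by
  intro h
  have hpos := G.edgeBump_pos e h0 h1
  rw [h, edgeBump_vertexPt] at hpos
  exact lt_irrefl _ hpos

theorem edgePt_notMem_vertexSet (G : DirectedGraph V E) {e : E} {t : unitInterval}
    (h0 : 0 < t) (h1 : t < 1) : G.edgePt e t ∉ G.vertexSet := by
  rintro ⟨v, hv⟩
  exact G.edgePt_ne_vertexPt h0 h1 v hv.symm

/-- The barycentric coordinates and the bumps on the edges separate the points of the graph: the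
bumps tell the edge, and the coordinate of its terminal vertex is the parameter on the edge, since
there are no looped edges. -/
instance (G : DirectedGraph V E) : T2Space G.Space := by
  classical
  refine T2Space.of_injective_continuous (f := fun x => (G.vertexCoord x, G.edgeBump x)) ?_ ?_
  · have key : ∀ (x : G.Space) e t, 0 < t → t < 1 →
        G.vertexCoord (G.edgePt e t) = G.vertexCoord x →
        G.edgeBump (G.edgePt e t) = G.edgeBump x → G.edgePt e t = x := by
      intro x e t h0 h1 hv hb
      have hpos := G.edgeBump_pos e h0 h1
      rcases G.vertexPt_or_edgePt x with ⟨v, rfl⟩ | ⟨d, u, -, -, rfl⟩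
      · rw [hb, edgeBump_vertexPt] at hpos
        exact absurd hpos (lt_irrefl _)
      · have hed : e = d := by
          by_contra hne
          rw [hb, G.edgeBump_edgePt_of_ne hne] at hpos
          exact lt_irrefl _ hpos
        subst hed
        have := congrFun hv (G.tgt e)
        rw [vertexCoord_edgePt_tgt, vertexCoord_edgePt_tgt] at this
        rw [Subtype.ext this]
    intro x y hxy
    obtain ⟨hv, hb⟩ := Prod.mk.inj hxy
    rcases G.vertexPt_or_edgePt x with ⟨v, rfl⟩ | ⟨e, t, h0, h1, rfl⟩
    · rcases G.vertexPt_or_edgePt y with ⟨w, rfl⟩ | ⟨e, t, h0, h1, rfl⟩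
      · have h' : (Pi.single v 1 : V → ℝ) = Pi.single w 1 := hv
        by_contra hne
        have hvw : v ≠ w := fun h => hne (h ▸ rfl)
        have := congrFun h' v
        simp [hvw] at this
      · exact (key _ e t h0 h1 hv.symm hb.symm).symm
    · exact key _ e t h0 h1 hv hb
  · refine Continuous.prodMk ?_ ?_
    · refine G.continuous_glueFun _ _ _ _ fun e => ?_
      fun_prop
    · refine G.continuous_glueFun _ _ _ _ fun e => ?_
      refine continuous_pi fun d => ?_
      by_cases h : d = e
      · subst h; simp only [Pi.single_eq_same]; fun_prop
      · simp only [Pi.single_eq_of_ne h]; fun_prop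

theorem isOpen_image_edgePt (G : DirectedGraph V E) (e : E) {U : Set unitInterval} (hU : IsOpen U)
    (h : U ⊆ Set.Ioo 0 1) : IsOpen (G.edgePt e '' U) := by
  have hq : Topology.IsQuotientMap (Quot.mk G.Glue) := isQuotientMap_quot_mk
  have : Quot.mk G.Glue ⁻¹' (G.edgePt e '' U) = Sum.inr '' (Sigma.mk e '' U) := by
    ext q
    constructor
    · rintro ⟨t, ht, hq⟩
      rcases q with ⟨v, ⟨⟩⟩ | ⟨d, u⟩
      · exact absurd hq (G.edgePt_ne_vertexPt (h ht).1 (h ht).2 v)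
      · obtain ⟨rfl, rfl⟩ := G.edgePt_eq_edgePt (h ht).1 (h ht).2 hq
        exact ⟨_, ⟨t, ht, rfl⟩, rfl⟩
    · rintro ⟨_, ⟨t, ht, rfl⟩, rfl⟩
      exact ⟨t, ht, rfl⟩
  refine hq.isOpen_preimage.1 ?_
  exact this ▸ isOpenMap_inr _ (isOpenMap_sigmaMk _ hU)

open Classical in
/-- The map of the graph onto a circle that collapses the complement of an open edge. -/
noncomputable def collapse (G : DirectedGraph V E) (e : E) : G.Space → AddCircle (1 : ℝ) :=
  G.glueFun (fun _ => 0) (fun d t => if d = e then ((t : ℝ) : AddCircle (1 : ℝ)) else 0)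
    (by intro d; split_ifs <;> simp) (by intro d; split_ifs <;> simp [AddCircle.coe_period])

theorem continuous_collapse (G : DirectedGraph V E) (e : E) : Continuous (G.collapse e) := by
  classical
  refine G.continuous_glueFun _ _ _ _ fun d => ?_
  by_cases h : d = e
  · simp only [if_pos h]
    exact (AddCircle.continuous_mk' 1).comp continuous_subtype_val
  · simp only [if_neg h]
    exact continuous_const

theorem collapse_edgePt (G : DirectedGraph V E) (e : E) (t : unitInterval) :
    G.collapse e (G.edgePt e t) = ((t : ℝ) : AddCircle (1 : ℝ)) := by
  simp [collapse, glueFun, edgePt]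

end DirectedGraph

/-! ### Arcs in a covering space of the graph and their coordinates -/

theorem IsCoveringMap.t2Space {T X : Type*} [TopologicalSpace T] [TopologicalSpace X] [T2Space X]
    {p : T → X} (hp : IsCoveringMap p) : T2Space T := by
  refine ⟨fun x y hxy => ?_⟩
  by_cases h : p x = p y
  · exact hp.isSeparatedMap x y h hxy
  · obtain ⟨u, v, hu, hv, hxu, hyv, huv⟩ := t2_separation h
    exact ⟨p ⁻¹' u, p ⁻¹' v, hu.preimage hp.continuous, hv.preimage hp.continuous, hxu, hyv,
      huv.preimage p⟩

theorem IsLocalHomeomorph.locallyPathConnectedSpace {T X : Type*} [TopologicalSpace T]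
    [TopologicalSpace X] [LocallyPathConnectedSpace X] {p : T → X} (hp : IsLocalHomeomorph p) :
    LocallyPathConnectedSpace T := by
  refine ⟨fun x => Filter.hasBasis_self.2 fun t ht => ?_⟩
  obtain ⟨e, hxe, -⟩ := hp x
  have hmem : e.target ∩ e.symm ⁻¹' t ∈ nhds (e x) := by
    refine Filter.inter_mem (e.open_target.mem_nhds (e.map_source hxe)) ?_
    refine (e.continuousAt_symm (e.map_source hxe)).preimage_mem_nhds ?_
    rwa [e.left_inv hxe]
  obtain ⟨s, ⟨hs, hsc⟩, hst⟩ := (path_connected_basis (e x)).mem_iff.1 hmem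
  refine ⟨e.symm '' s, ?_, ?_, ?_⟩
  · have := e.symm.image_mem_nhds (e.map_source hxe) hs
    rwa [e.left_inv hxe] at this
  · exact hsc.image' (e.continuousOn_symm.mono fun y hy => (hst hy).1)
  · rintro _ ⟨y, hy, rfl⟩
    exact (hst hy).2

theorem unitInterval.symm_pos_iff {t : unitInterval} : 0 < unitInterval.symm t ↔ t < 1 := by
  rw [← unitInterval.symm_one, unitInterval.strictAnti_symm.lt_iff_gt]

theorem unitInterval.symm_lt_one_iff {t : unitInterval} : unitInterval.symm t < 1 ↔ 0 < t := by
  rw [← unitInterval.symm_zero, unitInterval.strictAnti_symm.lt_iff_gt]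

namespace DirectedGraph

variable {V E : Type*} {G : DirectedGraph V E} {T : Type*} [TopologicalSpace T] {p : T → G.Space}

theorem orientedPt_not (G : DirectedGraph V E) (a : E × Bool) (t : unitInterval) :
    G.orientedPt (a.1, !a.2) t = G.orientedPt a (unitInterval.symm t) := by
  rcases a with ⟨e, b⟩
  cases b <;> simp [orientedPt]

theorem orientedPt_eq_orientedPt (G : DirectedGraph V E) {a b : E × Bool} {t u : unitInterval}
    (h0 : 0 < t) (h1 : t < 1) (h : G.orientedPt a t = G.orientedPt b u) :
    (a = b ∧ t = u) ∨ (b = (a.1, !a.2) ∧ t = unitInterval.symm u) := by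
  have h0' : 0 < unitInterval.symm t := unitInterval.symm_pos_iff.2 h1
  have h1' : unitInterval.symm t < 1 := unitInterval.symm_lt_one_iff.2 h0
  rcases a with ⟨e, a⟩
  rcases b with ⟨d, b⟩
  cases a <;> cases b
  · obtain ⟨rfl, htu⟩ := G.edgePt_eq_edgePt h0' h1' h
    exact Or.inl ⟨rfl, unitInterval.symm_bijective.injective htu⟩
  · obtain ⟨rfl, htu⟩ := G.edgePt_eq_edgePt h0' h1' h
    exact Or.inr ⟨rfl, by rw [← htu, unitInterval.symm_symm]⟩
  · obtain ⟨rfl, htu⟩ := G.edgePt_eq_edgePt h0 h1 h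
    exact Or.inr ⟨rfl, htu⟩
  · obtain ⟨rfl, htu⟩ := G.edgePt_eq_edgePt h0 h1 h
    exact Or.inl ⟨rfl, htu⟩

theorem orientedPt_zero (G : DirectedGraph V E) (a : E × Bool) :
    G.orientedPt a 0 = G.vertexPt (G.orientedSrc a) := by
  rcases a with ⟨e, _ | _⟩
  · simpa [orientedPt, orientedSrc] using G.edgePt_one e
  · simpa [orientedPt, orientedSrc] using G.edgePt_zero e

/-- The path `c` in the covering space is a lift of the oriented edge `a`. -/
def IsArc (G : DirectedGraph V E) (p : T → G.Space) (a : E × Bool) (c : C(unitInterval, T)) :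
    Prop := ∀ t, p (c t) = G.orientedPt a t

/-- The path `c` traversed backwards. -/
def revArc (c : C(unitInterval, T)) : C(unitInterval, T) :=
  c.comp ⟨unitInterval.symm, unitInterval.continuous_symm⟩

@[simp] theorem revArc_apply (c : C(unitInterval, T)) (t : unitInterval) :
    revArc c t = c (unitInterval.symm t) := rfl

theorem IsArc.rev {a : E × Bool} {c : C(unitInterval, T)} (hc : G.IsArc p a c) :
    G.IsArc p (a.1, !a.2) (revArc c) := by
  intro t
  rw [orientedPt_not, revArc_apply, hc]

/-- Two arcs whose open edges meet agree up to orientation. -/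
theorem IsArc.eq_or_eq_rev (hp : IsCoveringMap p) {a b : E × Bool} {c d : C(unitInterval, T)}
    (hc : G.IsArc p a c) (hd : G.IsArc p b d) {t u : unitInterval} (h0 : 0 < t) (h1 : t < 1)
    (h : c t = d u) : (a = b ∧ c = d ∧ t = u) ∨
      (b = (a.1, !a.2) ∧ d = revArc c ∧ t = unitInterval.symm u) := by
  have hpt : G.orientedPt a t = G.orientedPt b u := by rw [← hc, h, hd]
  rcases G.orientedPt_eq_orientedPt h0 h1 hpt with ⟨rfl, rfl⟩ | ⟨rfl, rfl⟩
  · refine Or.inl ⟨rfl, DFunLike.coe_injective ?_, rfl⟩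
    refine hp.eq_of_comp_eq c.continuous d.continuous ?_ t h
    ext s; exact (hc s).trans (hd s).symm
  · refine Or.inr ⟨rfl, DFunLike.coe_injective ?_, rfl⟩
    refine hp.eq_of_comp_eq d.continuous (revArc c).continuous ?_ u h.symm
    ext s; exact (hd s).trans (hc.rev s).symm

/-- The map `R` is a coordinate for the arc `c`: it is the parameter on the arc, and it takes only
the values `0` and `1` off the open arc. -/
def IsCoord (c : C(unitInterval, T)) (R : C(T, unitInterval)) : Prop :=
  (∀ t, R (c t) = t) ∧ ∀ x, 0 < R x → R x < 1 → c (R x) = x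

theorem IsCoord.rev {c : C(unitInterval, T)} {R : C(T, unitInterval)} (h : IsCoord c R) :
    IsCoord (revArc c) ((⟨unitInterval.symm, unitInterval.continuous_symm⟩ :
      C(unitInterval, unitInterval)).comp R) := by
  refine ⟨fun t => ?_, fun x h0 h1 => ?_⟩
  · simp [h.1]
  · have h0' : 0 < unitInterval.symm (R x) := h0
    have h1' : unitInterval.symm (R x) < 1 := h1
    have := h.2 x (unitInterval.symm_lt_one_iff.1 h1') (unitInterval.symm_pos_iff.1 h0')
    simpa using this

/-- An open arc is open: the covering map is a local homeomorphism that sends it homeomorphically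
onto an open edge. -/
theorem isOpen_image_arc (hp : IsCoveringMap p) {e : E} {c : C(unitInterval, T)}
    (hc : G.IsArc p (e, true) c) : IsOpen (c '' Set.Ioo 0 1) := by
  let j : Set.Ioo (0 : unitInterval) 1 → T := fun t => c t
  have hj : Topology.IsOpenEmbedding (p ∘ j) := by
    have hpj : p ∘ j = fun t : Set.Ioo (0 : unitInterval) 1 => G.edgePt e t := by
      ext t; exact hc t
    rw [hpj]
    refine Topology.IsOpenEmbedding.of_continuous_injective_isOpenMap
      ((G.continuous_edgePt e).comp continuous_subtype_val) ?_ ?_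
    · intro t u h
      exact Subtype.ext (G.edgePt_eq_edgePt t.2.1 t.2.2 h).2
    · intro U hU
      have h1 := G.isOpen_image_edgePt e (isOpen_Ioo.isOpenMap_subtype_val U hU)
        (by rintro _ ⟨t, -, rfl⟩; exact t.2)
      rwa [Set.image_image] at h1
  have h2 := (hp.isLocalHomeomorph.isOpenEmbedding_of_comp hj
    (c.continuous.comp continuous_subtype_val)).isOpen_range
  have h3 : Set.range j = c '' Set.Ioo 0 1 := by
    ext x
    simp [j, and_assoc]
  rwa [h3] at h2

/-- In a simply connected covering space every arc has a coordinate: the map to the circle that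
collapses the complement of the open arc lifts to the real line. -/
theorem exists_coord_of_forward [SimplyConnectedSpace T] (hp : IsCoveringMap p) {e : E}
    {c : C(unitInterval, T)} (hc : G.IsArc p (e, true) c) : ∃ R, IsCoord c R := by
  classical
  have : T2Space T := hp.t2Space
  have : LocallyPathConnectedSpace T := hp.isLocalHomeomorph.locallyPathConnectedSpace
  set U : Set T := c '' Set.Ioo 0 1
  have hUo : IsOpen U := isOpen_image_arc hp hc
  have hpc : ∀ t, p (c t) = G.edgePt e t := hc
  have hfr : ∀ x ∈ frontier U, G.collapse e (p x) = 0 := by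
    intro x hx
    rw [hUo.frontier_eq] at hx
    have hcl : closure U ⊆ Set.range c :=
      closure_minimal (Set.image_subset_range _ _) (isCompact_range c.continuous).isClosed
    obtain ⟨t, rfl⟩ := hcl hx.1
    rw [hpc, collapse_edgePt]
    by_cases h0 : t = 0
    · simp [h0]
    by_cases h1 : t = 1
    · simp [h1, AddCircle.coe_period]
    exact absurd ⟨t, ⟨unitInterval.pos_iff_ne_zero.2 h0, unitInterval.lt_one_iff_ne_one.2 h1⟩, rfl⟩
      hx.2
  let q : C(T, AddCircle (1 : ℝ)) := ⟨U.piecewise (fun x => G.collapse e (p x)) (fun _ => 0),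
    ((G.continuous_collapse e).comp hp.continuous).piecewise hfr continuous_const⟩
  have hqU : ∀ x ∈ U, q x = G.collapse e (p x) := fun x hx =>
    Set.piecewise_eq_of_mem U (fun x => G.collapse e (p x)) (fun _ => 0) hx
  have hqn : ∀ x ∉ U, q x = 0 := fun x hx =>
    Set.piecewise_eq_of_notMem U (fun x => G.collapse e (p x)) (fun _ => 0) hx
  have hqc : ∀ t, q (c t) = ((t : ℝ) : AddCircle (1 : ℝ)) := by
    intro t
    by_cases h : c t ∈ U
    · rw [hqU _ h, hpc, collapse_edgePt]
    · rw [hqn _ h]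
      by_cases h0 : t = 0
      · simp [h0]
      by_cases h1 : t = 1
      · simp [h1, AddCircle.coe_period]
      exact absurd ⟨t, ⟨unitInterval.pos_iff_ne_zero.2 h0,
        unitInterval.lt_one_iff_ne_one.2 h1⟩, rfl⟩ h
  have hcov := AddCircle.isCoveringMap_coe (1 : ℝ)
  obtain ⟨F, ⟨hF0, hF⟩, -⟩ := hcov.existsUnique_continuousMap_lifts q (c 0) 0 (by simp [hqc])
  have hFq : ∀ x, ((F x : ℝ) : AddCircle (1 : ℝ)) = q x := fun x => congrFun hF x
  have hFc : ∀ t, F (c t) = t := by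
    have := hcov.eq_of_comp_eq (g₁ := fun t => F (c t)) (g₂ := fun t : unitInterval => (t : ℝ))
      (F.continuous.comp c.continuous) continuous_subtype_val
      (by ext t; exact (hFq _).trans (hqc t)) 0 hF0
    exact fun t => congrFun this t
  refine ⟨⟨fun x => Set.projIcc 0 1 zero_le_one (F x), continuous_projIcc.comp F.continuous⟩,
    fun t => ?_, fun x h0 h1 => ?_⟩
  · change Set.projIcc 0 1 zero_le_one (F (c t)) = t
    rw [hFc, Set.projIcc_val]
  · change 0 < Set.projIcc 0 1 zero_le_one (F x) at h0
    change Set.projIcc 0 1 zero_le_one (F x) < 1 at h1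
    change c (Set.projIcc 0 1 zero_le_one (F x)) = x
    have h0' : 0 < F x := by
      by_contra h
      rw [Set.projIcc_of_le_left _ (not_lt.1 h)] at h0
      exact lt_irrefl _ h0
    have h1' : F x < 1 := by
      by_contra h
      rw [Set.projIcc_of_right_le _ (not_lt.1 h)] at h1
      exact lt_irrefl _ h1
    by_cases hx : x ∈ U
    · obtain ⟨t, -, rfl⟩ := hx
      rw [hFc, Set.projIcc_val]
    · -- off the open arc the lift takes only integer values
      have := hFq x
      rw [hqn x hx, AddCircle.coe_eq_zero_iff] at this
      obtain ⟨n, hn⟩ := this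
      rw [zsmul_eq_mul, mul_one] at hn
      rw [← hn] at h0' h1'
      have h2 : (0 : ℤ) < n := by exact_mod_cast h0'
      have h3 : n < (1 : ℤ) := by exact_mod_cast h1'
      omega

theorem exists_coord [SimplyConnectedSpace T] (hp : IsCoveringMap p) {a : E × Bool}
    {c : C(unitInterval, T)} (hc : G.IsArc p a c) : ∃ R, IsCoord c R := by
  rcases a with ⟨e, _ | _⟩
  · obtain ⟨R, hR⟩ := exists_coord_of_forward hp hc.rev
    have hcc : revArc (revArc c) = c := by ext t; simp
    exact ⟨_, hcc ▸ hR.rev⟩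
  · exact exists_coord_of_forward hp hc

end DirectedGraph

/-! ### Contracted paths in the covering tree -/

namespace DirectedGraph

variable {V E : Type*} {G : DirectedGraph V E} {T : Type*} [TopologicalSpace T] {p : T → G.Space}

/-- The arcs `W 0, …, W (N - 1)`, lifts of the oriented edges `a 0, …, a (N - 1)`, form a contracted
path in the covering space. -/
structure IsArcChain (G : DirectedGraph V E) (p : T → G.Space) (N : ℕ) (a : ℕ → E × Bool)
    (W : ℕ → C(unitInterval, T)) : Prop where
  isArc : ∀ i < N, G.IsArc p (a i) (W i)
  joined : ∀ i, i + 1 < N → W i 1 = W (i + 1) 0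
  contracted : ∀ i, i + 1 < N → a (i + 1) ≠ ((a i).1, !(a i).2)

theorem IsArcChain.rev {N : ℕ} {a : ℕ → E × Bool} {W : ℕ → C(unitInterval, T)}
    (h : G.IsArcChain p N a W) :
    G.IsArcChain p N (fun i => ((a (N - 1 - i)).1, !(a (N - 1 - i)).2))
      (fun i => revArc (W (N - 1 - i))) := by
  refine ⟨fun i hi => (h.isArc _ (by omega)).rev, fun i hi => ?_, fun i hi heq => ?_⟩
  · have := h.joined (N - 1 - (i + 1)) (by omega)
    rw [show N - 1 - (i + 1) + 1 = N - 1 - i by omega] at this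
    simp [this]
  · refine h.contracted (N - 1 - (i + 1)) (by omega) ?_
    rw [show N - 1 - (i + 1) + 1 = N - 1 - i by omega]
    obtain ⟨h1, h2⟩ := Prod.mk.inj heq
    ext
    · exact h1.symm
    · simpa using h2.symm

/-- A contracted path stays on the far side of each of its arcs once it has traversed it. -/
theorem IsArcChain.coord_end [SimplyConnectedSpace T] (hp : IsCoveringMap p) {N : ℕ}
    {a : ℕ → E × Bool} {W : ℕ → C(unitInterval, T)} (h : G.IsArcChain p N a W) (j : ℕ) :
    ∀ i ≤ j, j < N → ∀ R, IsCoord (W i) R → R (W j 1) = 1 := by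
  induction j with
  | zero =>
    intro i hi _ R hR
    obtain rfl : i = 0 := by omega
    exact hR.1 1
  | succ j ih =>
    intro i hi hj R hR
    rcases Nat.lt_or_ge j i with hij | hij
    · obtain rfl : i = j + 1 := by omega
      exact hR.1 1
    have hstart : R (W (j + 1) 0) = 1 := by
      rw [← h.joined j hj]; exact ih i hij (by omega) R hR
    by_contra hne
    -- otherwise the last arc meets the open arc `W i`, hence runs back along it
    obtain ⟨v, hv1, hv2⟩ := exists_between (unitInterval.lt_one_iff_ne_one.2 hne)
    have hv0 : 0 < v := lt_of_le_of_lt unitInterval.nonneg' hv1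
    obtain ⟨u, -, hu⟩ := intermediate_value_uIcc (f := fun u => R (W (j + 1) u)) (a := 0) (b := 1)
      (R.continuous.comp (W (j + 1)).continuous).continuousOn
      (show v ∈ Set.uIcc _ _ from Set.mem_uIcc.2 (Or.inr ⟨hv1.le, by rw [hstart]; exact hv2.le⟩))
    change R (W (j + 1) u) = v at hu
    have hmeet : W i v = W (j + 1) u := by
      have := hR.2 (W (j + 1) u) (by rw [hu]; exact hv0) (by rw [hu]; exact hv2)
      rwa [hu] at this
    rcases (h.isArc i (by omega)).eq_or_eq_rev hp (h.isArc (j + 1) hj) hv0 hv2 hmeet with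
      ⟨-, hW, -⟩ | ⟨ha, hW, -⟩
    · rw [← hW, hR.1] at hstart
      exact zero_ne_one hstart
    · rcases Nat.eq_or_lt_of_le hij with rfl | hlt
      · exact h.contracted i hj ha
      · obtain ⟨R', hR'⟩ := exists_coord hp (h.isArc (i + 1) (by omega))
        have h1 := ih (i + 1) hlt (by omega) R' hR'
        rw [h.joined j hj, hW, revArc_apply, unitInterval.symm_zero, h.joined i (by omega),
          hR'.1] at h1
        exact zero_ne_one h1

/-- Before a contracted path traverses one of its arcs it stays on the near side of it. -/
theorem IsArcChain.coord_start [SimplyConnectedSpace T] (hp : IsCoveringMap p) {N : ℕ}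
    {a : ℕ → E × Bool} {W : ℕ → C(unitInterval, T)} (h : G.IsArcChain p N a W) {i j : ℕ}
    (hji : j ≤ i) (hi : i < N) {R : C(T, unitInterval)} (hR : IsCoord (W i) R) :
    R (W j 0) = 0 := by
  have h1 := h.rev.coord_end hp (N - 1 - j) (N - 1 - i) (by omega) (by omega)
  simp only [show N - 1 - (N - 1 - i) = i by omega, show N - 1 - (N - 1 - j) = j by omega] at h1
  have h2 := h1 _ hR.rev
  simpa using h2

end DirectedGraph

/-! ### Crossings -/

theorem abs_sub_add_abs_sub_of_mem_uIcc {s t u : ℝ} (h : u ∈ Set.uIcc s t) :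
    |s - u| + |u - t| = |s - t| := by
  rcases Set.mem_uIcc.1 h with ⟨h1, h2⟩ | ⟨h1, h2⟩
  · rw [abs_of_nonpos (by linarith), abs_of_nonpos (by linarith), abs_of_nonpos (by linarith)]; ring
  · rw [abs_of_nonneg (by linarith), abs_of_nonneg (by linarith), abs_of_nonneg (by linarith)]; ring

theorem unitInterval.coe_mem_uIcc {s t u : unitInterval} :
    (u : ℝ) ∈ Set.uIcc (s : ℝ) t ↔ u ∈ Set.uIcc s t := by
  simp only [Set.mem_uIcc, Subtype.coe_le_coe]

/-- A closest pair of points at which a continuous function takes two given values bounds an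
interval in whose interior the function lies strictly between these values. -/
theorem exists_subinterval {h : unitInterval → unitInterval} (hh : Continuous h)
    {a b x y : unitInterval} (hxy : x ≠ y) (hx : x ∈ Set.uIcc (h a) (h b))
    (hy : y ∈ Set.uIcc (h a) (h b)) :
    ∃ s ∈ Set.uIcc a b, ∃ t ∈ Set.uIcc a b, h s = x ∧ h t = y ∧
      ∀ u ∈ Set.uIcc s t, u ≠ s → u ≠ t → h u ∈ Set.uIcc x y ∧ h u ≠ x ∧ h u ≠ y := by
  obtain ⟨s₀, hs₀, hs₀x⟩ := intermediate_value_uIcc hh.continuousOn hx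
  obtain ⟨t₀, ht₀, ht₀y⟩ := intermediate_value_uIcc hh.continuousOn hy
  let K : Set (unitInterval × unitInterval) :=
    {q | (q.1 ∈ Set.uIcc a b ∧ q.2 ∈ Set.uIcc a b) ∧ h q.1 = x ∧ h q.2 = y}
  have hK : IsCompact K := by
    refine IsClosed.isCompact ?_
    have hcl : IsClosed (Set.uIcc a b) := isClosed_Icc
    exact ((hcl.preimage continuous_fst).inter (hcl.preimage continuous_snd)).inter
      ((isClosed_eq (hh.comp continuous_fst) continuous_const).inter
        (isClosed_eq (hh.comp continuous_snd) continuous_const))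
  -- a pair at minimal distance: any further value in between would give a closer pair
  obtain ⟨⟨s, t⟩, ⟨⟨hs, ht⟩, hsx, hty⟩, hmin⟩ := hK.exists_isMinOn
    ⟨(s₀, t₀), ⟨hs₀, ht₀⟩, hs₀x, ht₀y⟩
    (f := fun q : unitInterval × unitInterval => |(q.1 : ℝ) - q.2|) (by fun_prop)
  simp only at hs ht hsx hty
  have hmin' : ∀ s' ∈ Set.uIcc s t, ∀ t' ∈ Set.uIcc s t, h s' = x → h t' = y →
      |(s : ℝ) - t| ≤ |(s' : ℝ) - t'| := fun s' hs' t' ht' h1 h2 =>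
    hmin (show (s', t') ∈ K from ⟨⟨Set.uIcc_subset_uIcc hs ht hs', Set.uIcc_subset_uIcc hs ht ht'⟩,
      h1, h2⟩)
  refine ⟨s, hs, t, ht, hsx, hty, fun u hu hus hut => ?_⟩
  have hadd := abs_sub_add_abs_sub_of_mem_uIcc (unitInterval.coe_mem_uIcc.2 hu)
  have hsu : 0 < |(s : ℝ) - u| := abs_pos.2 (sub_ne_zero.2 fun h => hus (Subtype.ext h.symm))
  have hut' : 0 < |(u : ℝ) - t| := abs_pos.2 (sub_ne_zero.2 fun h => hut (Subtype.ext h))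
  have hleft : ∀ t' ∈ Set.uIcc s u, h t' ≠ y := by
    intro t' ht' he
    have h1 := hmin' s Set.left_mem_uIcc t'
      (Set.uIcc_subset_uIcc Set.left_mem_uIcc hu ht') hsx he
    have h2 := abs_sub_add_abs_sub_of_mem_uIcc (unitInterval.coe_mem_uIcc.2 ht')
    linarith [abs_nonneg ((t' : ℝ) - u)]
  have hright : ∀ s' ∈ Set.uIcc u t, h s' ≠ x := by
    intro s' hs' he
    have h1 := hmin' s' (Set.uIcc_subset_uIcc hu Set.right_mem_uIcc hs') t
      Set.right_mem_uIcc he hty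
    have h2 := abs_sub_add_abs_sub_of_mem_uIcc (unitInterval.coe_mem_uIcc.2 hs')
    linarith [abs_nonneg ((u : ℝ) - s')]
  have hux := hright u Set.left_mem_uIcc
  have huy := hleft u Set.right_mem_uIcc
  refine ⟨?_, hux, huy⟩
  by_contra hout
  have hl : y ∉ Set.uIcc (h s) (h u) := fun hmem => by
    obtain ⟨t', ht', he⟩ := intermediate_value_uIcc hh.continuousOn hmem
    exact hleft t' ht' he
  have hr : x ∉ Set.uIcc (h u) (h t) := fun hmem => by
    obtain ⟨s', hs', he⟩ := intermediate_value_uIcc hh.continuousOn hmem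
    exact hright s' hs' he
  rw [hsx] at hl
  rw [hty] at hr
  simp only [Set.mem_uIcc, not_or, not_and_or, not_le] at hout hl hr
  rcases lt_or_gt_of_ne hxy with hlt | hlt <;> grind

theorem eq_or_eq_of_mem_uIcc {s t u : unitInterval} (hu : u = 0 ∨ u = 1) (h : u ∈ Set.uIcc s t) :
    u = s ∨ u = t := by
  have hs0 := unitInterval.nonneg' (t := s)
  have ht0 := unitInterval.nonneg' (t := t)
  have hs1 := unitInterval.le_one' (t := s)
  have ht1 := unitInterval.le_one' (t := t)
  rw [Set.mem_uIcc] at h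
  rcases hu with rfl | rfl <;> rcases h with ⟨h1, h2⟩ | ⟨h1, h2⟩
  · exact Or.inl (le_antisymm hs0 h1)
  · exact Or.inr (le_antisymm ht0 h1)
  · exact Or.inr (le_antisymm h2 ht1)
  · exact Or.inl (le_antisymm h2 hs1)

/-- An affine bijection, of either orientation, of the unit interval onto a nondegenerate
subinterval of it. -/
def IsAffineEmbedding (φ : unitInterval → unitInterval) : Prop :=
  ∃ A B : ℝ, B ≠ 0 ∧ ∀ u, (φ u : ℝ) = A + B * u

theorem IsAffineEmbedding.comp {φ ψ : unitInterval → unitInterval} (hφ : IsAffineEmbedding φ)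
    (hψ : IsAffineEmbedding ψ) : IsAffineEmbedding (φ ∘ ψ) := by
  obtain ⟨A, B, hB, h⟩ := hφ
  obtain ⟨A', B', hB', h'⟩ := hψ
  exact ⟨A + B * A', B * B', mul_ne_zero hB hB', fun u => by
    rw [Function.comp_apply, h, h']; ring⟩

section Crossing

variable {T : Type*} [TopologicalSpace T]

/-- The map `M` maps the subarc `φ([0,1])` of `c` linearly onto the arc `d`, and the map `F`
maps a subarc of `c` into `d`, its end points to the end points of `d`; the function `h` is the
parameter on `d` of the image under `F`, and `s`, which may be larger than `t`, is the end that goes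
to the start of `d`.  If an end point of this subarc is an end point of `c`, then the corresponding
end point of the subarc `φ([0,1])` is the same. -/
structure Crossing (F M : T → T) (c d : C(unitInterval, T)) (φ : unitInterval → unitInterval) :
    Prop where
  affine : IsAffineEmbedding φ
  linear : ∀ u, M (c (φ u)) = d u
  cross : ∃ (s t : unitInterval) (h : unitInterval → unitInterval), Continuous h ∧ h s = 0 ∧
    h t = 1 ∧ (∀ u ∈ Set.uIcc s t, F (c u) = d (h u)) ∧
    (s = 0 ∨ s = 1 → φ 0 = s) ∧ (t = 0 ∨ t = 1 → φ 1 = t)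

theorem Crossing.id (c : C(unitInterval, T)) : Crossing id id c c id :=
  ⟨⟨0, 1, one_ne_zero, fun u => by simp⟩, fun _ => rfl, 0, 1, _root_.id, continuous_id, rfl, rfl,
    fun _ _ => rfl, fun _ => rfl, fun _ => rfl⟩

theorem Crossing.rev {F M : T → T} {c d : C(unitInterval, T)} {φ : unitInterval → unitInterval}
    (h : Crossing F M c d φ) :
    Crossing F M c (DirectedGraph.revArc d) (φ ∘ unitInterval.symm) := by
  obtain ⟨ha, hl, s, t, k, hk, hs, ht, hF, h0, h1⟩ := h
  refine ⟨ha.comp ⟨1, -1, by norm_num, fun u => ?_⟩, fun u => hl _, t, s, unitInterval.symm ∘ k,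
    unitInterval.continuous_symm.comp hk, by simp [ht], by simp [hs], fun u hu => ?_, ?_, ?_⟩
  · rw [unitInterval.coe_symm_eq]; ring
  · rw [Set.uIcc_comm] at hu
    simp [hF u hu]
  · simpa using h1
  · simpa using h0

/-- Crossings compose.  An end point of `c` that survives in the composed crossing for `F` survives
in both crossings, so the condition on `φ` is inherited. -/
theorem Crossing.comp {F M F' M' : T → T} {c d e : C(unitInterval, T)}
    {φ ψ : unitInterval → unitInterval} (h : Crossing F M c d φ) (h' : Crossing F' M' d e ψ) :
    Crossing (F' ∘ F) (M' ∘ M) c e (φ ∘ ψ) := by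
  obtain ⟨ha, hl, s, t, k, hk, hs, ht, hF, h0, h1⟩ := h
  obtain ⟨ha', hl', s', t', k', hk', hs', ht', hF', h0', h1'⟩ := h'
  have hne : s' ≠ t' := by rintro rfl; rw [hs'] at ht'; exact zero_ne_one ht'
  have hmem : ∀ x : unitInterval, x ∈ Set.uIcc (k s) (k t) := fun x => by
    rw [hs, ht]; exact Set.mem_uIcc.2 (Or.inl ⟨unitInterval.nonneg', unitInterval.le_one'⟩)
  obtain ⟨s'', hs'', t'', ht'', es, et, hin⟩ := exists_subinterval hk hne (hmem s') (hmem t')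
  refine ⟨ha.comp ha', fun u => ?_, s'', t'', k' ∘ k, hk'.comp hk, ?_, ?_, fun u hu => ?_,
    fun hend => ?_, fun hend => ?_⟩
  · simp [hl, hl']
  · simp [es, hs']
  · simp [et, ht']
  · have hku : k u ∈ Set.uIcc s' t' := by
      by_cases hus : u = s''
      · rw [hus, es]; exact Set.left_mem_uIcc
      by_cases hut : u = t''
      · rw [hut, et]; exact Set.right_mem_uIcc
      exact (hin u hu hus hut).1
    simp [hF u (Set.uIcc_subset_uIcc hs'' ht'' hu), hF' _ hku]
  · rcases eq_or_eq_of_mem_uIcc hend hs'' with e | e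
    · rw [e, hs] at es
      rw [Function.comp_apply, h0' (Or.inl es.symm), ← es, h0 (e ▸ hend), e]
    · rw [e, ht] at es
      rw [Function.comp_apply, h0' (Or.inr es.symm), ← es, h1 (e ▸ hend), e]
  · rcases eq_or_eq_of_mem_uIcc hend ht'' with e | e
    · rw [e, hs] at et
      rw [Function.comp_apply, h1' (Or.inl et.symm), ← et, h0 (e ▸ hend), e]
    · rw [e, ht] at et
      rw [Function.comp_apply, h1' (Or.inr et.symm), ← et, h1 (e ▸ hend), e]

/-- The image of an arc under a homeomorphism. -/
def moveArc (g : T ≃ₜ T) (c : C(unitInterval, T)) : C(unitInterval, T) :=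
  (⟨g, g.continuous⟩ : C(T, T)).comp c

@[simp] theorem moveArc_apply (g : T ≃ₜ T) (c : C(unitInterval, T)) (t : unitInterval) :
    moveArc g c t = g (c t) := rfl

theorem moveArc_mul (g g' : T ≃ₜ T) (c : C(unitInterval, T)) :
    moveArc (g * g') c = moveArc g (moveArc g' c) := rfl

theorem Crossing.move {F M : T → T} {c d : C(unitInterval, T)} {φ : unitInterval → unitInterval}
    (h : Crossing F M c d φ) {g : T ≃ₜ T} (hF : ∀ a, F (g a) = g (F a))
    (hM : ∀ a, M (g a) = g (M a)) : Crossing F M (moveArc g c) (moveArc g d) φ := by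
  obtain ⟨ha, hl, s, t, k, hk, hs, ht, hk', h0, h1⟩ := h
  exact ⟨ha, fun u => by simp [hM, hl], s, t, k, hk, hs, ht, fun u hu => by simp [hF, hk' u hu],
    h0, h1⟩

/-- A crossing from an arc to itself, up to a homeomorphism, has a fixed point.  It can be chosen
in the interior unless `φ` fixes an end point. -/
theorem Crossing.exists_fixed {F M : T → T} {c : C(unitInterval, T)} {g : T ≃ₜ T}
    {φ : unitInterval → unitInterval} (h : Crossing F M c (moveArc g c) φ) :
    ∃ z, F (c z) = g (c z) ∧ (φ 0 ≠ 0 → φ 1 ≠ 1 → 0 < z ∧ z < 1) := by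
  obtain ⟨ha, hl, s, t, k, hk, hs, ht, hF, h0, h1⟩ := h
  obtain ⟨z, hz, hzk⟩ := intermediate_value_uIcc (f := fun u => (k u : ℝ) - u) (a := s) (b := t)
    (by fun_prop) (show (0 : ℝ) ∈ _ from Set.mem_uIcc.2 (Or.inl ⟨by
      simp only [hs]; simpa using s.2.1, by simp only [ht]; simpa using t.2.2⟩))
  have hkz : k z = z := Subtype.ext (sub_eq_zero.1 hzk)
  refine ⟨z, by rw [hF z hz, hkz, moveArc_apply], fun hφ0 hφ1 => ?_⟩
  have hz0 : z ≠ 0 := by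
    rintro rfl
    rcases eq_or_eq_of_mem_uIcc (Or.inl rfl) hz with e | e
    · exact hφ0 ((h0 (Or.inl e.symm)).trans e.symm)
    · rw [e, ht] at hkz
      exact one_ne_zero (hkz.trans e.symm)
  have hz1 : z ≠ 1 := by
    rintro rfl
    rcases eq_or_eq_of_mem_uIcc (Or.inr rfl) hz with e | e
    · rw [e, hs] at hkz
      exact zero_ne_one (hkz.trans e.symm)
    · exact hφ1 ((h1 (Or.inr e.symm)).trans e.symm)
  exact ⟨unitInterval.pos_iff_ne_zero.2 hz0, unitInterval.lt_one_iff_ne_one.2 hz1⟩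

end Crossing

/-! ### Crossings from itineraries of the linearization -/

namespace DirectedGraph

variable {V E : Type*} {G : DirectedGraph V E} {T : Type*} [TopologicalSpace T] {p : T → G.Space}

/-- In a tree, every path with the same end points as a contracted path crosses each arc of it. -/
theorem IsArcChain.exists_cross [SimplyConnectedSpace T] (hp : IsCoveringMap p) {N : ℕ}
    {a : ℕ → E × Bool} {W : ℕ → C(unitInterval, T)} (h : G.IsArcChain p N a W)
    {γ : C(unitInterval, T)} (h0 : γ 0 = W 0 0) (h1 : γ 1 = W (N - 1) 1) {j : ℕ} (hj : j < N) :
    ∃ (s t : unitInterval) (k : unitInterval → unitInterval), Continuous k ∧ k s = 0 ∧ k t = 1 ∧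
      (∀ u ∈ Set.uIcc s t, γ u = W j (k u)) ∧ s ≠ 1 ∧ t ≠ 0 ∧ (s = 0 → j = 0) ∧
      (t = 1 → j = N - 1) := by
  have : T2Space T := hp.t2Space
  obtain ⟨R, hR⟩ := exists_coord hp (h.isArc j hj)
  have hk : Continuous fun u => R (γ u) := R.continuous.comp γ.continuous
  have hk0 : R (γ 0) = 0 := by rw [h0]; exact h.coord_start hp (Nat.zero_le j) hj hR
  have hk1 : R (γ 1) = 1 := by
    rw [h1]; exact h.coord_end hp (N - 1) j (by omega) (by omega) R hR
  have hmem : ∀ x : unitInterval, x ∈ Set.uIcc (R (γ 0)) (R (γ 1)) := fun x => by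
    rw [hk0, hk1]; exact Set.mem_uIcc.2 (Or.inl ⟨unitInterval.nonneg', unitInterval.le_one'⟩)
  obtain ⟨s, -, t, -, hs, ht, hin⟩ := exists_subinterval hk zero_ne_one (hmem 0) (hmem 1)
  have hst : s ≠ t := by rintro rfl; rw [hs] at ht; exact zero_ne_one ht
  have hγ : ∀ u ∈ Set.uIcc s t, γ u = W j (R (γ u)) := by
    have hcl : IsClosed {u | γ u = W j (R (γ u))} :=
      isClosed_eq γ.continuous ((W j).continuous.comp hk)
    have hsub : Set.uIoo s t ⊆ {u | γ u = W j (R (γ u))} := by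
      intro u hu
      have hu' := Set.uIoo_subset_uIcc_self hu
      obtain ⟨-, hne0, hne1⟩ := hin u hu' (by rintro rfl; simp at hu) (by rintro rfl; simp at hu)
      exact (hR.2 _ (unitInterval.pos_iff_ne_zero.2 hne0)
        (unitInterval.lt_one_iff_ne_one.2 hne1)).symm
    rw [← closure_uIoo hst]
    exact closure_minimal hsub hcl
  refine ⟨s, t, fun u => R (γ u), hk, hs, ht, hγ, ?_, ?_, ?_, ?_⟩
  · rintro rfl
    rw [hk1] at hs
    exact one_ne_zero hs
  · rintro rfl
    rw [hk0] at ht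
    exact zero_ne_one ht
  · rintro rfl
    by_contra hj0
    -- the path would return to its starting point
    have e1 : W 0 0 = W (j - 1) 1 := by
      rw [h.joined (j - 1) (by omega), Nat.sub_add_cancel (by omega), ← h0,
        hγ 0 Set.left_mem_uIcc]
      exact congrArg _ hs
    obtain ⟨R', hR'⟩ := exists_coord hp (h.isArc 0 (by omega))
    have e2 := h.coord_end hp (j - 1) 0 (by omega) (by omega) R' hR'
    rw [← e1, hR'.1] at e2
    exact zero_ne_one e2
  · rintro rfl
    by_contra hjN
    -- the path would meet its end point twice
    have e1 : W (N - 1) 1 = W (j + 1) 0 := by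
      rw [← h.joined j (by omega), ← h1, hγ 1 Set.right_mem_uIcc]
      exact congrArg _ ht
    obtain ⟨R', hR'⟩ := exists_coord hp (h.isArc (N - 1) (by omega))
    have e2 := h.coord_start hp (i := N - 1) (j := j + 1) (by omega) (by omega) hR'
    rw [← e1, hR'.1] at e2
    exact one_ne_zero e2

/-- The affine map of the unit interval onto the `i`-th of `N` subintervals of equal length. -/
noncomputable def subdivide (N i : ℕ) (u : unitInterval) : unitInterval :=
  Set.projIcc 0 1 zero_le_one ((i + u) / N : ℝ)

theorem continuous_subdivide (N i : ℕ) : Continuous (subdivide N i) :=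
  continuous_projIcc.comp (by fun_prop)

theorem coe_subdivide {N i : ℕ} (hi : i < N) (u : unitInterval) :
    (subdivide N i u : ℝ) = (i + u) / N := by
  have hN : (0 : ℝ) < N := by exact_mod_cast (Nat.zero_le i).trans_lt hi
  have hi' : (i : ℝ) + 1 ≤ N := by exact_mod_cast hi
  rw [subdivide, Set.projIcc_of_mem]
  refine ⟨by have := u.2.1; positivity, ?_⟩
  rw [div_le_one hN]
  linarith [u.2.2]

/-- Let the arc `c` lie over an edge on which `L` is linear, and let `x` be an interior point of it
that is not mapped to a vertex.  Then the lift `f'` crosses, from `c`, the arc that contains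
`L' (c x)`. -/
theorem exists_crossing_step [SimplyConnectedSpace T] (hp : IsCoveringMap p)
    {L : C(G.Space, G.Space)} {f' L' : C(T, T)} (hlift : ∀ a, p (L' a) = L (p a))
    (heq : ∀ a, p a ∈ G.vertexSet → f' a = L' a) {e : E} (hL : G.IsLinearOnEdge L e)
    {c : C(unitInterval, T)} (hc : G.IsArc p (e, true) c) {x : unitInterval} (hx : x < 1)
    (hLx : L (G.edgePt e x) ∉ G.vertexSet) :
    ∃ d e₁ y φ, G.IsArc p (d, true) e₁ ∧ 0 < y ∧ y < 1 ∧ Crossing f' L' c e₁ φ ∧ φ y = x := by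
  obtain ⟨N, s, hN, hs, hlin⟩ := hL
  have hNr : (0 : ℝ) < N := by exact_mod_cast hN
  let a : ℕ → E × Bool := fun i => if h : i < N then s ⟨i, h⟩ else s ⟨0, hN⟩
  have ha : ∀ i (h : i < N), a i = s ⟨i, h⟩ := fun i h => dif_pos h
  let W : ℕ → C(unitInterval, T) := fun i =>
    ⟨fun u => L' (c (subdivide N i u)), L'.continuous.comp (c.continuous.comp
      (continuous_subdivide N i))⟩
  have hW : ∀ i u, W i u = L' (c (subdivide N i u)) := fun _ _ => rfl
  have hLs : ∀ i (h : i < N) u, L (G.edgePt e (subdivide N i u)) = G.orientedPt (a i) u := by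
    intro i h u
    rw [ha i h]
    refine hlin ⟨i, h⟩ _ u ?_
    rw [coe_subdivide h]
    field_simp
  have hpc : ∀ t, p (c t) = G.edgePt e t := hc
  have hchain : G.IsArcChain p N a W := by
    refine ⟨fun i hi u => ?_, fun i hi => ?_, fun i hi => ?_⟩
    · rw [hW, hlift, hpc, hLs i hi]
    · rw [hW, hW]
      congr 2
      refine Subtype.ext ?_
      rw [coe_subdivide (by omega), coe_subdivide hi]
      push_cast
      simp
    · rw [ha i (by omega), ha (i + 1) hi]
      exact (hs i hi).2
  have hx0 : (0 : ℝ) ≤ x * N := mul_nonneg x.2.1 hNr.le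
  set j : ℕ := ⌊(x : ℝ) * N⌋₊
  have hjle : (j : ℝ) ≤ x * N := Nat.floor_le hx0
  have hjlt : (x : ℝ) * N < j + 1 := Nat.lt_floor_add_one _
  have hxN : (x : ℝ) * N < N := by
    have : (x : ℝ) < 1 := hx
    nlinarith
  have hj : j < N := by
    have : (j : ℝ) < N := hjle.trans_lt hxN
    exact_mod_cast this
  let u : unitInterval := ⟨x * N - j, by linarith, by linarith⟩
  have hux : subdivide N j u = x := by
    refine Subtype.ext ?_
    rw [coe_subdivide hj]
    change ((j : ℝ) + (x * N - j)) / N = x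
    field_simp
    ring
  have hu1 : u < 1 := by
    have : (x : ℝ) * N - j < 1 := by linarith
    exact this
  have hu0 : 0 < u := by
    refine unitInterval.pos_iff_ne_zero.2 fun h0 => hLx ?_
    rw [← hux, hLs j hj, h0, orientedPt_zero]
    exact ⟨_, rfl⟩
  have hvert : ∀ t, t = 0 ∨ t = 1 → f' (c t) = L' (c t) := by
    intro t ht
    refine heq _ ?_
    rw [hpc]
    rcases ht with rfl | rfl
    · exact ⟨_, (G.edgePt_zero e).symm⟩
    · exact ⟨_, (G.edgePt_one e).symm⟩
  have hsub0 : subdivide N 0 0 = 0 := Subtype.ext (by rw [coe_subdivide hN]; simp)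
  have hsub1 : subdivide N (N - 1) 1 = 1 := by
    refine Subtype.ext ?_
    rw [coe_subdivide (by omega), Nat.cast_sub (by omega)]
    simp [hNr.ne']
  -- the ends of the two paths agree because both ends of `c` lie over vertices
  have hcross : Crossing f' L' c (W j) (subdivide N j) := by
    obtain ⟨s', t', k, hk, hs', ht', hin, hne1, hne0, hs0, ht1⟩ := hchain.exists_cross hp
      (γ := f'.comp c) (by rw [hW, hsub0]; exact hvert 0 (Or.inl rfl))
      (by rw [hW, hsub1]; exact hvert 1 (Or.inr rfl)) hj
    refine ⟨⟨j / N, 1 / N, by positivity, fun u => ?_⟩, fun u => rfl, s', t', k, hk, hs', ht', hin,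
      fun h => ?_, fun h => ?_⟩
    · rw [coe_subdivide hj]; ring
    · rcases h with rfl | h
      · rw [hs0 rfl, hsub0]
      · exact absurd h hne1
    · rcases h with h | rfl
      · exact absurd h hne0
      · rw [ht1 rfl, hsub1]
  have harc := hchain.isArc j hj
  rcases hab : a j with ⟨d, _ | _⟩
  · rw [hab] at harc
    refine ⟨d, revArc (W j), unitInterval.symm u, _, harc.rev, unitInterval.symm_pos_iff.2 hu1,
      unitInterval.symm_lt_one_iff.2 hu0, hcross.rev, ?_⟩
    simp [hux]
  · rw [hab] at harc
    exact ⟨d, W j, u, _, harc, hu0, hu1, hcross, hux⟩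

/-- A point that does not meet a vertex under `L` up to time `k` has an itinerary of arcs, and the
crossings between consecutive arcs of the itinerary compose. -/
theorem exists_crossing_iterate [SimplyConnectedSpace T] (hp : IsCoveringMap p)
    {L : C(G.Space, G.Space)} {f' L' : C(T, T)} (hlift : ∀ a, p (L' a) = L (p a))
    (heq : ∀ a, p a ∈ G.vertexSet → f' a = L' a) (hL : ∀ e, G.IsLinearOnEdge L e) {e : E}
    {c : C(unitInterval, T)} (hc : G.IsArc p (e, true) c) {x : unitInterval} (hx0 : 0 < x)
    (hx1 : x < 1) (k : ℕ) (hk : ∀ i ≤ k, L^[i] (G.edgePt e x) ∉ G.vertexSet) :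
    ∃ d e₁ y φ, G.IsArc p (d, true) e₁ ∧ 0 < y ∧ y < 1 ∧ Crossing f'^[k] L'^[k] c e₁ φ ∧
      φ y = x := by
  induction k with
  | zero => exact ⟨e, c, x, _, hc, hx0, hx1, Crossing.id c, rfl⟩
  | succ k ih =>
    obtain ⟨d, c₁, y, φ, hc₁, hy0, hy1, hcross, hφ⟩ := ih fun i hi => hk i (by omega)
    have hLy : L (G.edgePt d y) = L^[k + 1] (G.edgePt e x) := by
      have h1 : p (c₁ y) = L^[k] (p (c x)) := by
        rw [← hcross.linear y, hφ]
        exact (show Function.Semiconj p L' L from hlift).iterate_right k (c x)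
      rw [hc₁ y, hc x] at h1
      rw [Function.iterate_succ_apply']
      exact congrArg L h1
    obtain ⟨d', c₂, z, ψ, hc₂, hz0, hz1, hcross', hψ⟩ := exists_crossing_step hp hlift heq
      (hL d) hc₁ hy1 (by rw [hLy]; exact hk (k + 1) le_rfl)
    refine ⟨d', c₂, z, φ ∘ ψ, hc₂, hz0, hz1, ?_, by simp [hφ, hψ]⟩
    rw [Function.iterate_succ', Function.iterate_succ']
    exact hcross.comp hcross'

/-- If an iterate of the lift `L'` maps an interior point of an arc into the interior of a
translate of this arc, then the arc crosses this translate. -/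
theorem exists_crossing_of_linear [SimplyConnectedSpace T] (hp : IsCoveringMap p)
    {L : C(G.Space, G.Space)} {f' L' : C(T, T)} (hlift : ∀ a, p (L' a) = L (p a))
    (heq : ∀ a, p a ∈ G.vertexSet → f' a = L' a) (hL : ∀ e, G.IsLinearOnEdge L e)
    (hLV : Set.MapsTo L G.vertexSet G.vertexSet) {e : E} {c : C(unitInterval, T)}
    (hc : G.IsArc p (e, true) c) {x y : unitInterval} (hx0 : 0 < x) (hx1 : x < 1) (hy0 : 0 < y)
    (hy1 : y < 1) {k : ℕ} {g : T ≃ₜ T} (hg : ∀ a, p (g a) = p a)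
    (hxy : L'^[k] (c x) = g (c y)) :
    ∃ φ, Crossing f'^[k] L'^[k] c (moveArc g c) φ ∧ φ y = x := by
  have hk : ∀ i ≤ k, L^[i] (G.edgePt e x) ∉ G.vertexSet := by
    intro i hi hmem
    have h1 := (hLV.iterate (k - i)) hmem
    rw [← Function.iterate_add_apply, Nat.sub_add_cancel hi] at h1
    have h2 : p (L'^[k] (c x)) = L^[k] (p (c x)) :=
      (show Function.Semiconj p L' L from hlift).iterate_right k (c x)
    rw [hxy, hg, hc x, hc y] at h2
    exact G.edgePt_notMem_vertexSet hy0 hy1 (h2.symm ▸ h1 :)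
  obtain ⟨d, c₁, z, φ, hc₁, hz0, hz1, hcross, hφ⟩ :=
    exists_crossing_iterate hp hlift heq hL hc hx0 hx1 k hk
  have hgc : G.IsArc p (e, true) (moveArc g c) := fun t => (hg _).trans (hc t)
  have hmeet : c₁ z = moveArc g c y := by
    rw [← hcross.linear z, hφ, hxy, moveArc_apply]
  rcases hc₁.eq_or_eq_rev hp hgc hz0 hz1 hmeet with ⟨-, rfl, rfl⟩ | ⟨h, -⟩
  · exact ⟨φ, hcross, hφ⟩
  · -- both arcs are lifts of edges in the forward direction
    simp at h

end DirectedGraph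

/-! ### Affine maps of the unit interval -/

/-- An affine embedding maps interior points to interior points. -/
theorem IsAffineEmbedding.eq_zero_or_one {φ : unitInterval → unitInterval}
    (hφ : IsAffineEmbedding φ) {d : unitInterval} (h : φ d = 0 ∨ φ d = 1) : d = 0 ∨ d = 1 := by
  obtain ⟨A, B, hB, hAB⟩ := hφ
  by_contra hd
  rw [not_or] at hd
  have hd0 : (0 : ℝ) < d := unitInterval.pos_iff_ne_zero.2 hd.1
  have hd1 : (d : ℝ) < 1 := unitInterval.lt_one_iff_ne_one.2 hd.2
  have e0 := hAB 0
  have e1 := hAB 1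
  have ed := hAB d
  have b0 := (φ 0).2
  have b1 := (φ 1).2
  rw [e0] at b0
  rw [e1] at b1
  simp only [Set.Icc.coe_zero, Set.Icc.coe_one, mul_zero, mul_one, add_zero, Set.mem_Icc] at b0 b1
  rcases h with h | h <;> rw [h] at ed <;> simp only [Set.Icc.coe_zero, Set.Icc.coe_one] at ed <;>
    rcases lt_or_gt_of_ne hB with hB | hB <;> nlinarith

theorem IsAffineEmbedding.eq_of_eq_of_eq {φ ψ : unitInterval → unitInterval}
    (hφ : IsAffineEmbedding φ) (hψ : IsAffineEmbedding ψ) {s t : unitInterval} (hst : s ≠ t)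
    (hs : φ s = ψ s) (ht : φ t = ψ t) : φ = ψ := by
  obtain ⟨A, B, -, h⟩ := hφ
  obtain ⟨A', B', -, h'⟩ := hψ
  have es : A + B * s = A' + B' * s := by rw [← h, ← h', hs]
  have et : A + B * t = A' + B' * t := by rw [← h, ← h', ht]
  have hst' : (s : ℝ) - t ≠ 0 := sub_ne_zero.2 fun e => hst (Subtype.ext e)
  have hB : B = B' := by
    have : (B - B') * ((s : ℝ) - t) = 0 := by linarith
    exact sub_eq_zero.1 ((mul_eq_zero.1 this).resolve_right hst')
  funext u
  refine Subtype.ext ?_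
  rw [h, h']
  subst hB
  linarith

theorem isAffineEmbedding_id : IsAffineEmbedding id := ⟨0, 1, one_ne_zero, fun u => by simp⟩

theorem isAffineEmbedding_symm : IsAffineEmbedding unitInterval.symm :=
  ⟨1, -1, by norm_num, fun u => by rw [unitInterval.coe_symm_eq]; ring⟩

/-- An isometry of the unit interval: the identity or the reflection. -/
def IsFull (φ : unitInterval → unitInterval) : Prop := φ = id ∨ φ = unitInterval.symm

theorem IsFull.involutive {φ : unitInterval → unitInterval} (h : IsFull φ) :
    Function.Involutive φ := by
  rcases h with rfl | rfl
  · exact fun _ => rfl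
  · exact unitInterval.symm_symm

theorem IsFull.iterate {φ : unitInterval → unitInterval} (h : IsFull φ) (n : ℕ) :
    IsFull φ^[n] := by
  rcases Nat.even_or_odd n with hn | hn
  · exact Or.inl (h.involutive.iterate_even hn)
  · rwa [h.involutive.iterate_odd hn]

theorem IsAffineEmbedding.isFull_of_surjective {φ : unitInterval → unitInterval}
    (h : IsAffineEmbedding φ) (hs : Function.Surjective φ) : IsFull φ := by
  obtain ⟨s, hs0⟩ := hs 0
  obtain ⟨t, ht1⟩ := hs 1
  rcases h.eq_zero_or_one (Or.inl hs0) with rfl | rfl <;>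
    rcases h.eq_zero_or_one (Or.inr ht1) with rfl | rfl
  · exact absurd (hs0.symm.trans ht1) zero_ne_one
  · exact Or.inl (h.eq_of_eq_of_eq isAffineEmbedding_id zero_ne_one hs0 ht1)
  · exact Or.inr (h.eq_of_eq_of_eq isAffineEmbedding_symm zero_ne_one (by simp [ht1])
      (by simp [hs0]))
  · exact absurd (hs0.symm.trans ht1) zero_ne_one

theorem IsAffineEmbedding.isFull_of_iterate {φ : unitInterval → unitInterval}
    (h : IsAffineEmbedding φ) {n : ℕ} (hn : 0 < n) (hf : IsFull φ^[n]) : IsFull φ := by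
  obtain ⟨n, rfl⟩ := Nat.exists_eq_add_of_le' hn
  refine h.isFull_of_surjective ?_
  have hs := hf.involutive.surjective
  rw [Function.iterate_succ'] at hs
  exact hs.of_comp

/-- An affine self-map of the unit interval with an interior fixed point, other than the identity,
can take an end point as a value only at the opposite end point. -/
theorem IsAffineEmbedding.eq_symm_of_eq_endpoint {φ : unitInterval → unitInterval}
    (h : IsAffineEmbedding φ) (hf : ¬ IsFull φ) {x : unitInterval} (hx0 : 0 < x) (hx1 : x < 1)
    (hx : φ x = x) {c d : unitInterval} (hc : c = 0 ∨ c = 1) (hd : φ d = c) :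
    d = unitInterval.symm c := by
  have hd01 : d = 0 ∨ d = 1 := h.eq_zero_or_one (by rwa [hd])
  have hdc : d ≠ c := by
    rintro rfl
    refine hf (Or.inl (h.eq_of_eq_of_eq isAffineEmbedding_id (s := x) (t := d) ?_ hx hd))
    rintro rfl
    rcases hc with rfl | rfl
    · exact lt_irrefl _ hx0
    · exact lt_irrefl _ hx1
  rcases hc with rfl | rfl <;> rcases hd01 with rfl | rfl <;> simp_all

theorem IsAffineEmbedding.not_swap {φ : unitInterval → unitInterval} (h : IsAffineEmbedding φ)
    (hf : ¬ IsFull φ) {c : unitInterval} (hc : c = 0 ∨ c = 1) (h1 : φ (unitInterval.symm c) = c) :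
    φ c ≠ unitInterval.symm c := by
  intro h2
  refine hf (Or.inr (h.eq_of_eq_of_eq isAffineEmbedding_symm (s := unitInterval.symm c) (t := c)
    ?_ (by simp [h1]) h2))
  rcases hc with rfl | rfl <;> simp

/-! ### Words in two letters -/

/-- The composition of the maps given by the letters of a word. -/
def wordMap {ι X : Type*} (ψ : ι → X → X) : List ι → X → X
  | [] => id
  | b :: l => ψ b ∘ wordMap ψ l

theorem wordMap_replicate {ι X : Type*} (ψ : ι → X → X) (b : ι) (n : ℕ) :
    wordMap ψ (List.replicate n b) = (ψ b)^[n] := by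
  induction n with
  | zero => rfl
  | succ n ih => rw [List.replicate_succ, wordMap, ih, Function.iterate_succ']

/-- If every letter can take an end point as a value only at the opposite end point, and no letter
exchanges the end points, then a word that fixes an end point `c` alternates between two letters, of
which the second takes `c` to the opposite end point and the first takes it back. -/
theorem exists_alternating_of_wordMap_eq {ψ : Bool → unitInterval → unitInterval}
    (h1 : ∀ a c d, c = 0 ∨ c = 1 → ψ a d = c → d = unitInterval.symm c)
    (h2 : ∀ a c, c = 0 ∨ c = 1 → ψ a (unitInterval.symm c) = c → ψ a c ≠ unitInterval.symm c)
    {c : unitInterval} (hc : c = 0 ∨ c = 1) :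
    ∀ l : List Bool, l ≠ [] → wordMap ψ l c = c → ∃ a j, 0 < j ∧
      ψ a (unitInterval.symm c) = c ∧ ψ (!a) c = unitInterval.symm c ∧
      l = (List.replicate j [a, !a]).flatten
  | [], hl, _ => absurd rfl hl
  | [a], _, h => by
    have := h1 a c c hc h
    rcases hc with rfl | rfl <;> simp at this
  | a :: b :: l, _, h => by
    have hsc : unitInterval.symm c = 0 ∨ unitInterval.symm c = 1 := by
      rcases hc with rfl | rfl <;> simp
    have e1 : ψ b (wordMap ψ l c) = unitInterval.symm c := h1 a c _ hc h
    have e2 : wordMap ψ l c = c := by simpa using h1 b _ _ hsc e1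
    have ha : ψ a (unitInterval.symm c) = c := by rw [← e1]; exact h
    rw [e2] at e1
    have hb : b = !a := by
      rcases Bool.eq_or_eq_not b a with rfl | hb
      · exact absurd e1 (h2 b c hc ha)
      · exact hb
    subst hb
    rcases eq_or_ne l [] with rfl | hl
    · exact ⟨a, 1, one_pos, ha, e1, by simp⟩
    · obtain ⟨a', j, -, ha', hb', rfl⟩ := exists_alternating_of_wordMap_eq h1 h2 hc l hl e2
      have haa : a' = a := by
        rcases Bool.eq_or_eq_not a' a with haa | haa
        · exact haa
        · rw [haa, Bool.not_not] at hb'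
          exact absurd hb' (h2 a c hc ha)
      subst haa
      exact ⟨a', j + 1, Nat.succ_pos j, ha, e1, by simp [List.replicate_succ]⟩

theorem prod_map_flatten_replicate {ι M : Type*} [Monoid M] (v : ι → M) (a b : ι) (j : ℕ) :
    (((List.replicate j [a, b]).flatten).map v).prod = (v a * v b) ^ j := by
  induction j with
  | zero => simp
  | succ j ih => simp [List.replicate_succ, pow_succ', mul_assoc]

theorem sum_map_flatten_replicate {ι : Type*} (v : ι → ℕ) (a b : ι) (j : ℕ) :
    (((List.replicate j [a, b]).flatten).map v).sum = j * (v a + v b) := by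
  induction j with
  | zero => simp
  | succ j ih => simp [List.replicate_succ]; ring

theorem sum_map_eq_count (m n : ℕ) (l : List Bool) :
    (l.map fun b => if b then m else n).sum = l.count true * m + l.count false * n := by
  induction l with
  | nil => simp
  | cons b l ih => cases b <;> simp [ih] <;> ring

/-! ### Rotation elements -/

section Deck

variable {T X : Type*} [TopologicalSpace T] {p : T → X}

/-- A self-map of the covering space that commutes with the covering transformations. -/
def CommutesWithDeck (p : T → X) (F : T → T) : Prop := ∀ g ∈ deckGroup p, ∀ a, F (g a) = g (F a)

theorem CommutesWithDeck.iterate {F : T → T} (h : CommutesWithDeck p F) (n : ℕ) :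
    CommutesWithDeck p F^[n] := by
  intro g hg a
  exact ((show Function.Commute F g from h g hg).iterate_left n) a

/-- Covering transformations of a connected space that agree at a point are equal. -/
theorem deckGroup_ext [TopologicalSpace X] [PreconnectedSpace T] (hp : IsCoveringMap p)
    {g g' : deckGroup p} {a : T} (h : (g : T ≃ₜ T) a = (g' : T ≃ₜ T) a) : g = g' := by
  refine Subtype.ext (DFunLike.coe_injective ?_)
  refine hp.eq_of_comp_eq (g : T ≃ₜ T).continuous (g' : T ≃ₜ T).continuous ?_ a h
  ext b
  exact (g.2 b).trans (g'.2 b).symm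

theorem iterate_word_eq {ι : Type*} {F : T → T} (hF : CommutesWithDeck p F)
    {val : ι → deckGroup p} {len : ι → ℕ} {z : T}
    (h : ∀ b, F^[len b] z = (val b : T ≃ₜ T) z) (l : List ι) :
    F^[(l.map len).sum] z = ((l.map val).prod : deckGroup p).1 z := by
  induction l with
  | nil => rfl
  | cons b l ih =>
    rw [List.map_cons, List.sum_cons, add_comm, Function.iterate_add_apply, h b,
      hF.iterate _ _ (val b).2, ih]
    simp

theorem iterate_pow_eq {F : T → T} (hF : CommutesWithDeck p F) {g : deckGroup p} {k : ℕ} {z : T}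
    (h : F^[k] z = (g : T ≃ₜ T) z) (j : ℕ) : F^[j * k] z = ((g ^ j : deckGroup p) : T ≃ₜ T) z := by
  simpa using iterate_word_eq (ι := Unit) (val := fun _ => g) (len := fun _ => k) hF (fun _ => h)
    (List.replicate j ())

/-- The crossing of a word.  The first letter acts first, and the later letters are moved by its
covering transformation, so the covering transformations multiply from left to right. -/
theorem crossing_word {ι : Type*} {F M : T → T} (hF : CommutesWithDeck p F)
    (hM : CommutesWithDeck p M) {val : ι → deckGroup p} {len : ι → ℕ}
    {ψ : ι → unitInterval → unitInterval} {c : C(unitInterval, T)}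
    (h : ∀ b, Crossing F^[len b] M^[len b] c (moveArc (val b : T ≃ₜ T) c) (ψ b)) (l : List ι) :
    Crossing F^[(l.map len).sum] M^[(l.map len).sum] c
      (moveArc ((l.map val).prod : deckGroup p).1 c) (wordMap ψ l) := by
  induction l with
  | nil => exact Crossing.id c
  | cons b l ih =>
    have h2 := (h b).comp (ih.move (hF.iterate _ _ (val b).2) (hM.iterate _ _ (val b).2))
    rw [← Function.iterate_add, ← Function.iterate_add, add_comm] at h2
    simpa [← moveArc_mul, wordMap] using h2

theorem crossing_pow {F M : T → T} (hF : CommutesWithDeck p F)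
    (hM : CommutesWithDeck p M) {g : deckGroup p} {k : ℕ}
    {φ : unitInterval → unitInterval} {c : C(unitInterval, T)}
    (h : Crossing F^[k] M^[k] c (moveArc (g : T ≃ₜ T) c) φ) (j : ℕ) :
    Crossing F^[j * k] M^[j * k] c (moveArc ((g ^ j : deckGroup p) : T ≃ₜ T) c) φ^[j] := by
  have := crossing_word (ι := Unit) (val := fun _ => g) (len := fun _ => k) (ψ := fun _ => φ)
    hF hM (fun _ => h) (List.replicate j ())
  simpa [wordMap_replicate] using this

end Deck

/-- If the subarc `φ([0,1])` ends inside the arc, then so does the subarc crossed by `F`. -/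
theorem Crossing.exists_interior {T : Type*} [TopologicalSpace T] {F M : T → T}
    {c d : C(unitInterval, T)} {φ : unitInterval → unitInterval} (h : Crossing F M c d φ)
    {b : unitInterval} (hb : b = 0 ∨ b = 1) (hφ : φ b ≠ 0 ∧ φ b ≠ 1) :
    ∃ u, 0 < u ∧ u < 1 ∧ F (c u) = d b := by
  obtain ⟨-, -, s, t, k, -, hs, ht, hk, h0, h1⟩ := h
  rcases hb with rfl | rfl
  · refine ⟨s, unitInterval.pos_iff_ne_zero.2 fun e => ?_,
      unitInterval.lt_one_iff_ne_one.2 fun e => ?_, by rw [hk s Set.left_mem_uIcc, hs]⟩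
    · exact hφ.1 ((h0 (Or.inl e)).trans e)
    · exact hφ.2 ((h0 (Or.inr e)).trans e)
  · refine ⟨t, unitInterval.pos_iff_ne_zero.2 fun e => ?_,
      unitInterval.lt_one_iff_ne_one.2 fun e => ?_, by rw [hk t Set.right_mem_uIcc, ht]⟩
    · exact hφ.1 ((h1 (Or.inl e)).trans e)
    · exact hφ.2 ((h1 (Or.inr e)).trans e)

namespace DirectedGraph

variable {V E : Type*} {G : DirectedGraph V E} {T : Type*} [TopologicalSpace T] {p : T → G.Space}

/-- If two interior points of an arc are mapped to the two end points of a translate of the arc,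
then some interior point between them is mapped to its own translate. -/
theorem exists_interior_fixed [SimplyConnectedSpace T] (hp : IsCoveringMap p) {a : E × Bool}
    {c : C(unitInterval, T)} (hc : G.IsArc p a c) {g : T ≃ₜ T} (hg : g ∈ deckGroup p) {F : T → T}
    (hF : Continuous F)
    (h : ∀ b : unitInterval, b = 0 ∨ b = 1 → ∃ u, 0 < u ∧ u < 1 ∧ F (c u) = g (c b)) :
    ∃ z, 0 < z ∧ z < 1 ∧ F (c z) = g (c z) := by
  obtain ⟨s, hs0, hs1, hs⟩ := h 0 (Or.inl rfl)
  obtain ⟨t, ht0, ht1, ht⟩ := h 1 (Or.inr rfl)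
  have hgc : G.IsArc p a (moveArc g c) := fun t => (hg _).trans (hc t)
  obtain ⟨R, hR⟩ := exists_coord hp hgc
  have hRs : R (F (c s)) = 0 := by rw [hs]; exact hR.1 0
  have hRt : R (F (c t)) = 1 := by rw [ht]; exact hR.1 1
  obtain ⟨z, hz, hzR⟩ := intermediate_value_uIcc (f := fun u => (R (F (c u)) : ℝ) - u) (a := s)
    (b := t) (by fun_prop) (show (0 : ℝ) ∈ _ from Set.mem_uIcc.2 (Or.inl ⟨by
      simp only [hRs]; simpa using s.2.1, by simp only [hRt]; simpa using t.2.2⟩))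
  have hz' : R (F (c z)) = z := Subtype.ext (sub_eq_zero.1 hzR)
  have hz0 : 0 < z := lt_of_lt_of_le (lt_min hs0 ht0) hz.1
  have hz1 : z < 1 := lt_of_le_of_lt hz.2 (max_lt hs1 ht1)
  refine ⟨z, hz0, hz1, ?_⟩
  have := hR.2 (F (c z)) (by rwa [hz']) (by rwa [hz'])
  rw [hz'] at this
  exact this.symm

/-- The middle of the unit interval. -/
noncomputable def half : unitInterval := ⟨1 / 2, by norm_num, by norm_num⟩

theorem _root_.IsFull.apply_half {φ : unitInterval → unitInterval} (h : IsFull φ) :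
    φ half = half := by
  rcases h with rfl | rfl
  · rfl
  · refine Subtype.ext ?_
    rw [unitInterval.coe_symm_eq, half]
    norm_num

theorem half_pos : 0 < half := by
  have : (0 : ℝ) < 1 / 2 := by norm_num
  exact this

theorem half_lt_one : half < 1 := by
  have : (1 / 2 : ℝ) < 1 := by norm_num
  exact this

/-! ### The induced lift of the linearization -/

section InducedLift

variable {f L : C(G.Space, G.Space)} {f' L' : C(T, T)}

theorem IsInducedLift.lifts (h : G.IsInducedLift p f L f' L') (a : T) : p (L' a) = L (p a) := by
  obtain ⟨H, H', hH⟩ := h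
  rw [← H'.apply_one, hH, H.apply_one]

theorem IsInducedLift.eq_on_vertices (hp : IsCoveringMap p) (h : G.IsInducedLift p f L f' L')
    {a : T} (ha : p a ∈ G.vertexSet) : f' a = L' a := by
  obtain ⟨H, H', hH⟩ := h
  rw [← H'.apply_zero, ← H'.apply_one]
  refine hp.const_of_comp (g := fun s => H' (s, a)) (by fun_prop) (fun s s' => ?_) 0 1
  rw [hH, hH, H.eq_fst s ha, H.eq_fst s' ha]

theorem IsInducedLift.commutesWithDeck (hp : IsCoveringMap p) (h : G.IsInducedLift p f L f' L')
    (hf' : CommutesWithDeck p f') : CommutesWithDeck p L' := by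
  obtain ⟨H, H', hH⟩ := h
  intro g hg a
  have := hp.eq_of_comp_eq (g₁ := fun s => H' (s, g a)) (g₂ := fun s => g (H' (s, a)))
    (by fun_prop) (by fun_prop) (by ext s; simp [hH, hg a, hg (H' (s, a))]) 0
    (by simp [hf' g hg a])
  have h1 := congrFun this 1
  simpa using h1

theorem iterate_eq_on_vertices (hlift : ∀ a, p (L' a) = L (p a))
    (heq : ∀ a, p a ∈ G.vertexSet → f' a = L' a) (hLV : Set.MapsTo L G.vertexSet G.vertexSet)
    {a : T} (ha : p a ∈ G.vertexSet) (k : ℕ) : f'^[k] a = L'^[k] a := by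
  induction k generalizing a with
  | zero => rfl
  | succ k ih =>
    rw [Function.iterate_succ_apply, Function.iterate_succ_apply, heq a ha]
    refine ih ?_
    rw [hlift]
    exact hLV ha

end InducedLift

theorem IsArc.injective [SimplyConnectedSpace T] (hp : IsCoveringMap p) {a : E × Bool}
    {c : C(unitInterval, T)} (hc : G.IsArc p a c) : Function.Injective c := by
  obtain ⟨R, hR⟩ := exists_coord hp hc
  intro s t h
  rw [← hR.1 s, h, hR.1]

/-- If `M` maps an arc isometrically onto a translate of it, then there is no other subarc that it
maps affinely onto a translate of the arc. -/
theorem eq_of_isFull [SimplyConnectedSpace T] (hp : IsCoveringMap p) {e : E}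
    {c : C(unitInterval, T)} (hc : G.IsArc p (e, true) c) {M : T → T} {g g' : deckGroup p}
    {φ ψ : unitInterval → unitInterval} (hφ : IsFull φ)
    (h : ∀ u, M (c (φ u)) = (g : T ≃ₜ T) (c u))
    (h' : ∀ u, M (c (ψ u)) = (g' : T ≃ₜ T) (c u)) : g = g' ∧ φ = ψ := by
  have key : ∀ u, (g : T ≃ₜ T) (c (φ (ψ u))) = (g' : T ≃ₜ T) (c u) := by
    intro u
    rw [← h, hφ.involutive, h']
  have hhalf : φ (ψ half) = half := by
    have h1 := congrArg p (key half)
    rw [g.2, g'.2, hc, hc] at h1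
    exact (G.edgePt_eq_edgePt half_pos half_lt_one h1.symm).2.symm
  obtain rfl : g = g' := by
    refine deckGroup_ext hp (a := c half) ?_
    rw [← key half, hhalf]
  refine ⟨rfl, funext fun u => ?_⟩
  have h1 := hc.injective hp ((g : T ≃ₜ T).injective (key u))
  rw [← h1, hφ.involutive, h1]

/-! ### Crossings with rotation elements -/

section Main

variable [SimplyConnectedSpace T] {L : C(G.Space, G.Space)} {f' L' : C(T, T)} {e : E}
  {c : C(unitInterval, T)}

/-- Suppose that for both letters an iterate of `L'` maps the arc `c` isometrically onto a
translate, and not both of these maps preserve the orientation.  The least iterate of `L'` that maps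
the middle of `c` to a translate of it then reverses the arc, so that the corresponding iterate of
`f'` has an interior fixed point up to a covering transformation, and both letters are powers of
this iterate. -/
theorem exists_interior_of_isFull (hp : IsCoveringMap p) (hlift : ∀ a, p (L' a) = L (p a))
    (heq : ∀ a, p a ∈ G.vertexSet → f' a = L' a) (hL : ∀ e, G.IsLinearOnEdge L e)
    (hLV : Set.MapsTo L G.vertexSet G.vertexSet) (hf' : CommutesWithDeck p f')
    (hL' : CommutesWithDeck p L') (hc : G.IsArc p (e, true) c) {val : Bool → deckGroup p}
    {len : Bool → ℕ} {ψ : Bool → unitInterval → unitInterval} (hlen : ∀ b, 0 < len b)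
    (hcross : ∀ b, Crossing f'^[len b] L'^[len b] c (moveArc (val b : T ≃ₜ T) c) (ψ b))
    (hfull : ∀ b, IsFull (ψ b)) (hid : ¬ ∀ b, ψ b = id) :
    ∃ z, 0 < z ∧ z < 1 ∧ ∀ b, f'^[len b] (c z) = (val b : T ≃ₜ T) (c z) := by
  classical
  have hmid : ∀ b, L'^[len b] (c half) = (val b : T ≃ₜ T) (c half) := by
    intro b
    have := (hcross b).linear half
    rwa [(hfull b).apply_half] at this
  have hex : ∃ d, 0 < d ∧ ∃ g : deckGroup p, L'^[d] (c half) = (g : T ≃ₜ T) (c half) :=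
    ⟨len true, hlen true, val true, hmid true⟩
  obtain ⟨hd, g, hg⟩ := Nat.find_spec hex
  set d := Nat.find hex
  have hdvd : ∀ b, ∃ j, len b = j * d ∧ val b = g ^ j := by
    intro b
    set j := len b / d
    set r := len b % d
    have hjr : r + j * d = len b := Nat.mod_add_div' _ _
    have h1 : L'^[r] (c half) = ((g ^ j)⁻¹ * val b : deckGroup p).1 (c half) := by
      have h2 := hmid b
      rw [← hjr, Function.iterate_add_apply, iterate_pow_eq hL' hg,
        hL'.iterate r _ (g ^ j).2] at h2
      rw [Subgroup.coe_mul, Homeomorph.mul_apply, ← h2, ← Homeomorph.mul_apply,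
        ← Subgroup.coe_mul, inv_mul_cancel]
      rfl
    have hr : r = 0 := by
      by_contra hr
      exact Nat.find_min hex (Nat.mod_lt _ hd) ⟨Nat.pos_of_ne_zero hr, _, h1⟩
    rw [hr] at h1
    have h3 : (1 : deckGroup p) = (g ^ j)⁻¹ * val b := deckGroup_ext hp (a := c half) h1
    exact ⟨j, by omega, (inv_mul_eq_one.1 h3.symm).symm⟩
  obtain ⟨φ, hφ, -⟩ := exists_crossing_of_linear hp hlift heq hL hLV hc half_pos half_lt_one
    half_pos half_lt_one g.2 hg
  have hpow : ∀ b, ∃ j, 0 < j ∧ φ^[j] = ψ b := by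
    intro b
    obtain ⟨j, hj, hv⟩ := hdvd b
    have h1 := (crossing_pow hf' hL' hφ j).linear
    rw [← hj, ← hv] at h1
    refine ⟨j, Nat.pos_of_ne_zero ?_, (eq_of_isFull hp hc (hfull b) (hcross b).linear h1).2.symm⟩
    rintro rfl
    have := hlen b
    omega
  have hφfull : IsFull φ := by
    obtain ⟨j, hj, h⟩ := hpow true
    exact hφ.affine.isFull_of_iterate hj (h ▸ hfull true)
  have hφsymm : φ = unitInterval.symm := by
    refine hφfull.resolve_left ?_
    rintro rfl
    refine hid fun b => ?_
    obtain ⟨j, -, h⟩ := hpow b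
    rw [← h, Function.iterate_id]
  obtain ⟨z, hz, hz01⟩ := hφ.exists_fixed
  obtain ⟨hz0, hz1⟩ := hz01 (by simp [hφsymm]) (by simp [hφsymm])
  refine ⟨z, hz0, hz1, fun b => ?_⟩
  obtain ⟨j, hj, hv⟩ := hdvd b
  rw [hj, hv]
  exact iterate_pow_eq hf' hz j

/-- If one letter is an isometry of the arc, then both are: the powers of the two letters of the
same length `len a * len b` coincide. -/
theorem isFull_of_isFull (hp : IsCoveringMap p) (hf' : CommutesWithDeck p f')
    (hL' : CommutesWithDeck p L') (hc : G.IsArc p (e, true) c) {val : Bool → deckGroup p}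
    {len : Bool → ℕ} {ψ : Bool → unitInterval → unitInterval} (hlen : ∀ b, 0 < len b)
    (hcross : ∀ b, Crossing f'^[len b] L'^[len b] c (moveArc (val b : T ≃ₜ T) c) (ψ b)) {a : Bool}
    (ha : IsFull (ψ a)) (b : Bool) : IsFull (ψ b) := by
  have h1 := (crossing_pow hf' hL' (hcross a) (len b)).linear
  have h2 := (crossing_pow hf' hL' (hcross b) (len a)).linear
  rw [mul_comm (len a)] at h2
  have h3 := (eq_of_isFull hp hc (ha.iterate _) h1 h2).2
  exact (hcross b).affine.isFull_of_iterate (hlen a) (h3 ▸ ha.iterate _)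

/-- Suppose that one letter takes the end point `c₀` to the opposite end point, that the other one
takes it back, and that the covering transformations commute.  The two words of two different
letters then have the same length and the same product; the crossing of each of them keeps one end
point of the arc, but not the same one, and its other end lies inside the arc. -/
theorem exists_interior_of_commute (hp : IsCoveringMap p) (hf' : CommutesWithDeck p f')
    (hL' : CommutesWithDeck p L') (hc : G.IsArc p (e, true) c) {val : Bool → deckGroup p}
    {len : Bool → ℕ} {ψ : Bool → unitInterval → unitInterval}
    (hcross : ∀ b, Crossing f'^[len b] L'^[len b] c (moveArc (val b : T ≃ₜ T) c) (ψ b))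
    (h1 : ∀ a c d, c = 0 ∨ c = 1 → ψ a d = c → d = unitInterval.symm c)
    (h2 : ∀ a c, c = 0 ∨ c = 1 → ψ a (unitInterval.symm c) = c → ψ a c ≠ unitInterval.symm c)
    {c₀ : unitInterval} (hc₀ : c₀ = 0 ∨ c₀ = 1) {a : Bool}
    (ha : ψ a (unitInterval.symm c₀) = c₀) (hb : ψ (!a) c₀ = unitInterval.symm c₀)
    (hcomm : val a * val (!a) = val (!a) * val a) :
    ∃ z, 0 < z ∧ z < 1 ∧
      f'^[len a + len (!a)] (c z) = ((val a * val (!a) : deckGroup p) : T ≃ₜ T) (c z) := by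
  have hsc : unitInterval.symm c₀ = 0 ∨ unitInterval.symm c₀ = 1 := by
    rcases hc₀ with rfl | rfl <;> simp
  refine exists_interior_fixed hp hc (val a * val (!a)).2 (f'.continuous.iterate _) ?_
  have hstart : ∃ u, 0 < u ∧ u < 1 ∧ f'^[len a + len (!a)] (c u) =
      ((val a * val (!a) : deckGroup p) : T ≃ₜ T) (c (unitInterval.symm c₀)) := by
    have hw := crossing_word hf' hL' hcross [a, !a]
    simp only [List.map_cons, List.map_nil, List.sum_cons, List.sum_nil, List.prod_cons,
      List.prod_nil, mul_one, add_zero] at hw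
    refine hw.exists_interior hsc ?_
    have key : ∀ b, b = 0 ∨ b = 1 → wordMap ψ [a, !a] (unitInterval.symm c₀) ≠ b := by
      intro b hb01 he
      have e1 : ψ (!a) (unitInterval.symm c₀) = unitInterval.symm b := h1 _ _ _ hb01 he
      have e2 := h1 _ _ _ (by rcases hb01 with rfl | rfl <;> simp) e1
      rw [unitInterval.symm_symm] at e2
      subst e2
      rw [unitInterval.symm_symm] at e1
      exact h2 _ _ hc₀ e1 hb
    exact ⟨key 0 (Or.inl rfl), key 1 (Or.inr rfl)⟩
  have hend : ∃ u, 0 < u ∧ u < 1 ∧ f'^[len a + len (!a)] (c u) =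
      ((val a * val (!a) : deckGroup p) : T ≃ₜ T) (c c₀) := by
    have hw := crossing_word hf' hL' hcross [!a, a]
    simp only [List.map_cons, List.map_nil, List.sum_cons, List.sum_nil, List.prod_cons,
      List.prod_nil, mul_one, add_zero] at hw
    rw [← hcomm, add_comm] at hw
    refine hw.exists_interior hc₀ ?_
    have key : ∀ b, b = 0 ∨ b = 1 → wordMap ψ [!a, a] c₀ ≠ b := by
      intro b hb01 he
      have e1 : ψ a c₀ = unitInterval.symm b := h1 _ _ _ hb01 he
      have e2 := h1 _ _ _ (by rcases hb01 with rfl | rfl <;> simp) e1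
      rw [unitInterval.symm_symm] at e2
      subst e2
      exact h2 _ _ hc₀ ha e1
    exact ⟨key 0 (Or.inl rfl), key 1 (Or.inr rfl)⟩
  intro b hb01
  rcases hc₀ with rfl | rfl <;> rcases hb01 with rfl | rfl
  · exact hend
  · simpa using hstart
  · simpa using hstart
  · exact hend

end Main

end DirectedGraph

theorem mainTheorem1 {V E : Type*} [Finite V] [Finite E] (G : DirectedGraph V E)
    [ConnectedSpace G.Space]
    {T : Type*} [TopologicalSpace T] [SimplyConnectedSpace T]
    (p : T → G.Space) (hp : IsCoveringMap p)
    (f L : C(G.Space, G.Space)) (f' L' : C(T, T))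
    (hf : G.IsVertexMap f) (hid : f.Homotopic (ContinuousMap.id G.Space))
    (hf' : IsEquivariantLift p f f')
    (hL : G.IsLinearization f L) (hL' : G.IsInducedLift p f L f' L')
    (e : E) (e' : C(unitInterval, T)) (he' : ∀ t, p (e' t) = G.edgePt e t)
    (x y : unitInterval) (hx : 0 < x ∧ x < 1) (hy : 0 < y ∧ y < 1)
    (m n : ℕ)
    (hxm : Function.IsPeriodicPt L m (G.edgePt e x))
    (hyn : Function.IsPeriodicPt L n (G.edgePt e y))
    (α β : deckGroup p)
    (hα : HasRotationElement L' (e' x) (α, m)) (hβ : HasRotationElement L' (e' y) (β, n)) :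
    ∀ q ∈ rotationSet α m β n,
      (∃ z : unitInterval, Function.IsPeriodicPt f q.2 (G.edgePt e z) ∧
        HasRotationElement f' (e' z) q) ∧
      (¬ (∀ t, L^[m] (G.edgePt e t) = G.edgePt e t ∧ L^[n] (G.edgePt e t) = G.edgePt e t) →
        ¬ (α * β ≠ β * α ∧
            (∃ j : ℕ, 0 < j ∧ q.2 = j * (m + n) ∧ (q.1 = (α * β) ^ j ∨ q.1 = (β * α) ^ j)) ∧
            ((f'^[m] (e' 0) = (α : T ≃ₜ T) (e' 1) ∧ f'^[n] (e' 1) = (β : T ≃ₜ T) (e' 0)) ∨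
              (f'^[m] (e' 1) = (α : T ≃ₜ T) (e' 0) ∧ f'^[n] (e' 0) = (β : T ≃ₜ T) (e' 1)))) →
        ∃ z : unitInterval, 0 < z ∧ z < 1 ∧ Function.IsPeriodicPt f q.2 (G.edgePt e z) ∧
          HasRotationElement f' (e' z) q) := by
  have hc : G.IsArc p (e, true) e' := he'
  have hlift := hL'.lifts
  have heq : ∀ a, p a ∈ G.vertexSet → f' a = L' a := fun a ha => hL'.eq_on_vertices hp ha
  have hfc : CommutesWithDeck p f' := hf'.2
  have hLc := hL'.commutesWithDeck hp hfc
  have hLV : Set.MapsTo L G.vertexSet G.vertexSet := by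
    obtain ⟨H⟩ := hL.1
    intro a ha
    rw [← H.fst_eq_snd ha]
    exact hf.mapsTo ha
  obtain ⟨φ, hφ, hφx⟩ := DirectedGraph.exists_crossing_of_linear hp hlift heq hL.2 hLV hc hx.1 hx.2
    hx.1 hx.2 α.2 hα.2
  obtain ⟨χ, hχ, hχy⟩ := DirectedGraph.exists_crossing_of_linear hp hlift heq hL.2 hLV hc hy.1 hy.2
    hy.1 hy.2 β.2 hβ.2
  let val : Bool → deckGroup p := fun b => if b then α else β
  let len : Bool → ℕ := fun b => if b then m else n
  let ψ : Bool → unitInterval → unitInterval := fun b => if b then φ else χ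
  have hlen : ∀ b, 0 < len b := by
    rintro (_ | _)
    · exact hβ.1
    · exact hα.1
  have hcross : ∀ b, Crossing f'^[len b] L'^[len b] e' (moveArc (val b : T ≃ₜ T) e') (ψ b) := by
    rintro (_ | _)
    · exact hχ
    · exact hφ
  have hper : ∀ (k : ℕ) (g : deckGroup p) (z : unitInterval),
      f'^[k] (e' z) = (g : T ≃ₜ T) (e' z) → Function.IsPeriodicPt f k (G.edgePt e z) := by
    intro k g z h
    have h1 : p (f'^[k] (e' z)) = f^[k] (p (e' z)) :=
      (show Function.Semiconj p f' f from hf'.1).iterate_right k (e' z)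
    rw [h, g.2, he'] at h1
    exact h1.symm
  rintro ⟨v, k⟩ ⟨l, hl, hv, hk⟩
  simp only at hv hk ⊢
  have hk' : k = (l.map len).sum := by rw [hk, ← sum_map_eq_count]
  have hkpos : 0 < k := by
    rw [hk']
    obtain ⟨b, l, rfl⟩ := List.exists_cons_of_ne_nil hl
    rw [List.map_cons, List.sum_cons]
    exact Nat.add_pos_left (hlen b) _
  -- the letter `true` of the word stands for `α`, and `false` for `β`
  have hword := crossing_word hfc hLc hcross l
  rw [← hk'] at hword
  change Crossing f'^[k] L'^[k] e' (moveArc ((l.map fun b => if b then α else β).prod :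
    deckGroup p).1 e') (wordMap ψ l) at hword
  rw [← hv] at hword
  obtain ⟨z, hz, hz01⟩ := hword.exists_fixed
  refine ⟨⟨z, hper k v z hz, hkpos, hz⟩, fun hnid hnexc => ?_⟩
  suffices h : ∃ z, 0 < z ∧ z < 1 ∧ f'^[k] (e' z) = (v : T ≃ₜ T) (e' z) by
    obtain ⟨z, hz0, hz1, hz⟩ := h
    exact ⟨z, hz0, hz1, hper k v z hz, hkpos, hz⟩
  by_cases hfull : ∃ a, IsFull (ψ a)
  · obtain ⟨a, ha⟩ := hfull
    have hfull := DirectedGraph.isFull_of_isFull hp hfc hLc hc hlen hcross ha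
    -- otherwise both iterates of `L` are the identity on the edge
    have hnot : ¬ ∀ b, ψ b = id := by
      intro hall
      have hiter : ∀ b t, L^[len b] (G.edgePt e t) = G.edgePt e t := by
        intro b t
        have h1 : p (L'^[len b] (e' t)) = L^[len b] (p (e' t)) :=
          (show Function.Semiconj p L' L from hlift).iterate_right _ (e' t)
        have h2 := (hcross b).linear t
        rw [hall b, id, moveArc_apply] at h2
        rw [h2, (val b).2, he'] at h1
        exact h1.symm
      exact hnid fun t => ⟨hiter true t, hiter false t⟩
    obtain ⟨z, hz0, hz1, hz⟩ := DirectedGraph.exists_interior_of_isFull hp hlift heq hL.2 hLV hfc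
      hLc hc hlen hcross hfull hnot
    refine ⟨z, hz0, hz1, ?_⟩
    rw [hk', iterate_word_eq hfc hz l, hv]
  · rw [not_exists] at hfull
    have h1 : ∀ a c d, c = 0 ∨ c = 1 → ψ a d = c → d = unitInterval.symm c := by
      rintro (_ | _) c d hc01 hd
      · exact hχ.affine.eq_symm_of_eq_endpoint (hfull false) hy.1 hy.2 hχy hc01 hd
      · exact hφ.affine.eq_symm_of_eq_endpoint (hfull true) hx.1 hx.2 hφx hc01 hd
    have h2 : ∀ a c, c = 0 ∨ c = 1 → ψ a (unitInterval.symm c) = c →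
        ψ a c ≠ unitInterval.symm c := fun a c hc01 h =>
      (hcross a).affine.not_swap (hfull a) hc01 h
    by_cases hend : ∃ c, (c = 0 ∨ c = 1) ∧ wordMap ψ l c = c
    · obtain ⟨c, hc01, hcw⟩ := hend
      obtain ⟨a, j, hj, ha, hb, rfl⟩ := exists_alternating_of_wordMap_eq h1 h2 hc01 l hl hcw
      have hvj : v = (val a * val (!a)) ^ j := hv.trans (prod_map_flatten_replicate val a (!a) j)
      have hkj : k = j * (len a + len (!a)) :=
        hk'.trans (sum_map_flatten_replicate len a (!a) j)
      by_cases hcomm : α * β = β * α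
      · obtain ⟨z, hz0, hz1, hz⟩ := DirectedGraph.exists_interior_of_commute hp hfc hLc hc hcross
          h1 h2 hc01 ha hb (by cases a <;> simp [val, hcomm])
        exact ⟨z, hz0, hz1, by rw [hkj, hvj]; exact iterate_pow_eq hfc hz j⟩
      · exfalso
        have hends : ∀ b d, d = 0 ∨ d = 1 → ∀ d', ψ b d' = d →
            f'^[len b] (e' d) = (val b : T ≃ₜ T) (e' d') := by
          intro b d hd d' hdd
          rw [DirectedGraph.iterate_eq_on_vertices hlift heq hLV, ← hdd, (hcross b).linear,
            moveArc_apply]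
          rw [he']
          rcases hd with rfl | rfl
          · exact ⟨_, (G.edgePt_zero e).symm⟩
          · exact ⟨_, (G.edgePt_one e).symm⟩
        have e1 := hends a c hc01 _ ha
        have e2 := hends (!a) (unitInterval.symm c) (by rcases hc01 with rfl | rfl <;> simp) _ hb
        refine hnexc ⟨hcomm, ⟨j, hj, ?_, ?_⟩, ?_⟩
        · rw [hkj]
          cases a <;> simp [len, add_comm]
        · rw [hvj]
          cases a <;> simp [val]
        · cases a <;> rcases hc01 with rfl | rfl
          · exact Or.inr ⟨by simpa [len, val] using e2, by simpa [len, val] using e1⟩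
          · exact Or.inl ⟨by simpa [len, val] using e2, by simpa [len, val] using e1⟩
          · exact Or.inl ⟨by simpa [len, val] using e1, by simpa [len, val] using e2⟩
          · exact Or.inr ⟨by simpa [len, val] using e1, by simpa [len, val] using e2⟩
    · have hne : ∀ c, c = 0 ∨ c = 1 → wordMap ψ l c ≠ c := fun c hc01 h => hend ⟨c, hc01, h⟩
      obtain ⟨hz0, hz1⟩ := hz01 (hne 0 (Or.inl rfl)) (hne 1 (Or.inr rfl))
      exact ⟨z, hz0, hz1, hz⟩
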